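/- **Setting.** $G=(V,E,\mathsf{wt})$ is a finite weighted directed graph with $n$ nodes, $E\subseteq V\times V$ (self-loops are allowed), $\mathsf{wt}:E\to\mathbb Z$, and $\mathsf{wt}(u,v)=\infty$ for $(u,v)\notin E$. A *cycle* is a sequence of nodes $C=(u_1,\dots,u_j)$ with $j>1$, $u_1=u_j$ and $(u_i,u_{i+1})\in E$ for all $i<j$; it is *simple* if $u_2,\dots,u_j$ are distinct; its weight is $\mathsf{wt}(C)=\sum_{i<j}\mathsf{wt}(u_i,u_{i+1})$. Let $c^*$ be the smallest weight of a simple cycle ($c^*=\infty$ if there is no cycle). A rooted *tree decomposition* of $G$ is a rooted tree whose vertices are subsets $B_0,\dots,B_{n'-1}$ of $V$ (bags; repetitions are allowed), such that every node lies in a bag, both ends of every edge lie in a common bag, and $B_i\cap B_j\subseteq B_k$ whenever $B_k$ is on the tree path between $B_i$ and $B_j$. Its width is the size of its largest bag minus $1$. It is *binary* if every bag has at most two children. The level of a bag is its distance from the root. The *root bag* of a node $x$ is the bag of smallest level that contains $x$. **Algorithm $\mathsf{MinCycle}$.** Given $G$ and a binary tree decomposition, set $c\leftarrow\infty$, and traverse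 the tree in post-order. For each bag $B$, with children $B_1,B_2$ (if they exist): 1. For all $u,v\in B$ set $\mathsf{LD}_B(u,v)\leftarrow\min(\mathsf{LD}_{B_1}(u,v),\mathsf{LD}_{B_2}(u,v),\mathsf{wt}(u,v))$, where $\mathsf{LD}_{B_i}(u,v)=\infty$ if $B_i$ does not exist or $\{u,v\}\not\subseteq B_i$. Discard $\mathsf{LD}_{B_1}$ and $\mathsf{LD}_{B_2}$. 2. For each node $x$ whose root bag is $B$ (one after the other, if there are several): for all $u,v\in B$ set $\mathsf{LD}'_B(u,v)\leftarrow\min(\mathsf{LD}_B(u,v),\mathsf{LD}_B(u,x)+\mathsf{LD}_B(x,v))$; then set $\mathsf{LD}_B\leftarrow\mathsf{LD}'_B$ and $c\leftarrow\min(c,\mathsf{LD}_B(x,x))$. At the end return $c$. The algorithm is implemented as a program of a random access machine whose words hold integers or $\infty$. The input is read-only: parent, children, size and nodes of a bag, and $\mathsf{wt}(u,v)$ for a pair of nodes, are obtained by queries of unit cost. Time is the number of elementary operations (arithmetic operations, comparisons, memory accesses, queries, control steps), and additional space is the number of machine words used, not counting the input. **Theorem.** For all constants $t,a,b\in\mathbb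 N$ there is a constant $C\in\mathbb N$ such that the following holds for every weighted directed graph $G$ with $n$ nodes and every binary tree decomposition of $G$ that has width at most $t$, a number $n'\le a\cdot n$ of bags, and all levels at most $b\cdot(\lfloor\log_2 n'\rfloor+1)$ (that is, the tree decomposition is balanced). The program $\mathsf{MinCycle}$ halts within time $C\cdot n$ and, if $n\ge 2$, uses at most $C\cdot\lfloor\log_2 n\rfloor$ words of additional space. It returns a value $c$ such that: 1. If $G$ has no negative cycle, then $c=c^*$. 2. If $G$ has a negative cycle, then $c$ and $c^*$ are integers, $c\le c^*$ and $|c^*|\le|c|$, and, if $n\ge 2$, also $|c|\le|c^*|\cdot n^{C}$. -/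

import Mathlib

/-! ## Weighted directed graphs, paths and cycles -/

/-- A finite weighted directed graph with nodes `0, …, n - 1`. Self-loops are allowed. The weight
function matters on edges only; its values on other pairs are never used. -/
structure WeightedDigraph (n : ℕ) extends Digraph (Fin n) where
  wt : Fin n → Fin n → ℤ

namespace WeightedDigraph

variable {n : ℕ} (G : WeightedDigraph n)

/-- A finite path `(u₁, …, u_j)`, `j ≥ 1`: consecutive nodes are joined by an edge. -/
def IsPath (p : List (Fin n)) : Prop :=
  p ≠ [] ∧ p.IsChain G.Adj

/-- A cycle is a path `(u₁, …, u_j)` with `j > 1` and `u₁ = u_j`. -/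
def IsCycle (p : List (Fin n)) : Prop :=
  G.IsPath p ∧ 1 < p.length ∧ p.head? = p.getLast?

/-- A cycle `(u₁, …, u_j)` is simple if no node is repeated in `(u₂, …, u_j)`. -/
def IsSimpleCycle (p : List (Fin n)) : Prop :=
  G.IsCycle p ∧ p.tail.Nodup

/-- The weight of a path is the sum of the weights of its edges, with multiplicity. -/
def pathWeight : List (Fin n) → ℤ
  | u :: v :: p => G.wt u v + pathWeight (v :: p)
  | _ => 0

/-- Some cycle (simple or not) has negative weight. -/
def HasNegativeCycle : Prop :=
  ∃ p, G.IsCycle p ∧ G.pathWeight p < 0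

/-- The weights of the simple cycles. -/
def simpleCycleWeights : Set (WithTop ℤ) :=
  {w | ∃ p, G.IsSimpleCycle p ∧ w = (G.pathWeight p : ℤ)}

/-- The smallest weight `c*` of a simple cycle; it is `∞` if there is no cycle. -/
noncomputable def minCycleWeight : WithTop ℤ :=
  sInf G.simpleCycleWeights

theorem simpleCycleWeights_finite : G.simpleCycleWeights.Finite := by
  have h : {p : List (Fin n) | G.IsSimpleCycle p}.Finite := by
    refine (List.finite_length_le (Fin n) (n + 1)).subset ?_
    intro p hp
    have h1 := hp.2.length_le_card
    simp only [List.length_tail, Fintype.card_fin] at h1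
    simp only [Set.mem_ofPred_eq]
    omega
  refine (h.image fun p => ((G.pathWeight p : ℤ) : WithTop ℤ)).subset ?_
  rintro w ⟨p, hp, rfl⟩
  exact ⟨p, hp, rfl⟩

/-- The infimum is a minimum as soon as a simple cycle exists. -/
theorem isLeast_minCycleWeight (h : G.simpleCycleWeights.Nonempty) :
    IsLeast G.simpleCycleWeights G.minCycleWeight := by
  obtain ⟨w, hw⟩ := Set.exists_min_image _ id G.simpleCycleWeights_finite h
  have hl : IsLeast G.simpleCycleWeights w := ⟨hw.1, fun x hx => hw.2 x hx⟩
  have : G.minCycleWeight = w := hl.csInf_eq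
  rw [this]
  exact hl

theorem minCycleWeight_eq_top (h : G.simpleCycleWeights = ∅) : G.minCycleWeight = ⊤ := by
  rw [minCycleWeight, h, WithTop.sInf_empty]

end WeightedDigraph

/-! ## Tree decompositions -/

/-- A rooted tree decomposition of `G` with bags `B₀, …, B_{m-1}`: a tree on the indices of the
bags such that every node and every edge is covered, and such that `Bᵢ ∩ Bⱼ ⊆ Bₖ` for every bag
`Bₖ` on the simple path of the tree between `Bᵢ` and `Bⱼ`. -/
structure TreeDecomposition {n : ℕ} (G : WeightedDigraph n) (m : ℕ) where
  tree : SimpleGraph (Fin m)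
  isTree : tree.IsTree
  root : Fin m
  bag : Fin m → Finset (Fin n)
  node_covered : ∀ u, ∃ i, u ∈ bag i
  edge_covered : ∀ u v, G.Adj u v → ∃ i, u ∈ bag i ∧ v ∈ bag i
  contiguous : ∀ (i j k : Fin m) (p : tree.Walk i j), p.IsPath → k ∈ p.support →
    bag i ∩ bag j ⊆ bag k

namespace TreeDecomposition

variable {n : ℕ} {G : WeightedDigraph n} {m : ℕ} (D : TreeDecomposition G m)

/-- The level of a bag: its distance from the root. -/
noncomputable def level (i : Fin m) : ℕ :=
  D.tree.dist D.root i

/-- The bag `j` is a child of the bag `i` (equivalently, `i` is the parent of `j`). -/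
def IsChild (i j : Fin m) : Prop :=
  D.tree.Adj i j ∧ D.level j = D.level i + 1

/-- Every bag has at most two children. -/
def IsBinary : Prop :=
  ∀ i, {j | D.IsChild i j}.ncard ≤ 2

/-- The width is at most `t`: every bag has at most `t + 1` nodes. -/
def WidthAtMost (t : ℕ) : Prop :=
  ∀ i, (D.bag i).card ≤ t + 1

/-- The levels are at most `b` times the logarithm (plus one) of the number of bags. -/
def BalancedWith (b : ℕ) : Prop :=
  ∀ i, D.level i ≤ b * (Nat.log 2 m + 1)

/-- A listing of the decomposition, as it is stored in memory: the nodes of each bag and the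
children of each bag, in an arbitrary order, and the parent of each bag. -/
structure Listing where
  nodes : Fin m → List (Fin n)
  nodes_nodup : ∀ i, (nodes i).Nodup
  mem_nodes : ∀ i u, u ∈ nodes i ↔ u ∈ D.bag i
  children : Fin m → List (Fin m)
  children_nodup : ∀ i, (children i).Nodup
  mem_children : ∀ i j, j ∈ children i ↔ D.IsChild i j
  parent : Fin m → Option (Fin m)
  parent_eq_some : ∀ i j, parent j = some i ↔ D.IsChild i j

theorem isChild_unique {i i' j : Fin m} (h : D.IsChild i j) (h' : D.IsChild i' j) : i = i' := by
  have key : ∀ (i : Fin m) (p : D.tree.Walk D.root i), p.length = D.tree.dist D.root i →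
      ∀ h : D.IsChild i j, (p.concat h.1).IsPath := by
    intro i p hl h
    apply SimpleGraph.Walk.isPath_of_length_eq_dist
    rw [SimpleGraph.Walk.length_concat, hl]
    exact h.2.symm
  obtain ⟨p, -, hp⟩ := (D.isTree.connected.preconnected D.root i).exists_path_of_dist
  obtain ⟨q, -, hq⟩ := (D.isTree.connected.preconnected D.root i').exists_path_of_dist
  have := D.isTree.isAcyclic.subsingleton_path D.root j
  have e : (⟨_, key i p hp h⟩ : D.tree.Path D.root j) = ⟨_, key i' q hq h'⟩ :=
    Subsingleton.elim _ _
  simpa using congrArg (fun x => x.1.penultimate) e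

/-- Every rooted tree decomposition can be listed. -/
theorem exists_listing : Nonempty D.Listing := by
  classical
  refine ⟨⟨fun i => (D.bag i).toList, fun i => Finset.nodup_toList _, by simp,
    fun i => (Finset.univ.filter (D.IsChild i)).toList, fun i => Finset.nodup_toList _, by simp,
    fun j => if h : ∃ i, D.IsChild i j then some h.choose else none, fun i j => ?_⟩⟩
  split_ifs with h
  · constructor
    · intro e
      cases e
      exact h.choose_spec
    · intro e
      rw [D.isChild_unique e h.choose_spec]
  · simp only [false_iff]
    exact fun e => h ⟨_, e⟩

end TreeDecomposition

/-! ## A random access machine with read-only input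

Programs are structured (assignments, conditionals, counted loops). They work on finitely many
registers and on a random access work memory. A word holds an integer or `∞`; the word `∞` also
serves as the null pointer. The input is read-only and is accessed by constant-time queries. -/

/-- A machine word: an integer or `∞`. -/
abbrev Word : Type := WithTop ℤ

/-- The natural number that a word denotes when it is used as an address or as a loop bound. -/
def Word.toNat (w : Word) : ℕ :=
  (WithTop.untopD 0 w).toNat

/-- The read-only input of a program, as the table of answers to its queries. -/
structure RamInput where
  numBags : Word
  root : Word
  parent : Word → Word
  child : Word → Word → Word
  bagSize : Word → Word
  bagNode : Word → Word → Word
  weight : Word → Word → Word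

/-- Expressions over the set `R` of registers. -/
inductive Expr (R : Type) where
  | const (w : Word)
  | reg (r : R)
  | mem (a : Expr R)
  | add (x y : Expr R)
  | sub (x y : Expr R)
  | mul (x y : Expr R)
  | min (x y : Expr R)
  | numBags
  | root
  | parent (b : Expr R)
  | child (b i : Expr R)
  | bagSize (b : Expr R)
  | bagNode (b i : Expr R)
  | weight (u v : Expr R)

instance {R : Type} : Add (Expr R) := ⟨Expr.add⟩
instance {R : Type} : Sub (Expr R) := ⟨Expr.sub⟩
instance {R : Type} : Mul (Expr R) := ⟨Expr.mul⟩
instance {R : Type} : Coe R (Expr R) := ⟨Expr.reg⟩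

/-- Programs over the set `R` of registers. -/
inductive Prog (R : Type) where
  | skip
  /-- `r := e` -/
  | assign (r : R) (e : Expr R)
  /-- `memory[a] := e` -/
  | store (a e : Expr R)
  | seq (p q : Prog R)
  /-- if `x = y` then `p` else `q` -/
  | ifEq (x y : Expr R) (p q : Prog R)
  /-- for `r = 0, 1, …, e - 1` do `p`; the bound `e` is evaluated once, before the loop -/
  | loop (r : R) (e : Expr R) (p : Prog R)

/-- Execute a list of programs one after the other. -/
def Prog.block {R : Type} : List (Prog R) → Prog R
  | [] => .skip
  | p :: ps => .seq p (Prog.block ps)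

/-- A state of the machine: the contents of the registers and of the work memory, the number
`used` of cells of the work memory up to the highest address written so far, and the number `time`
of elementary operations performed so far. -/
structure RamState (R : Type) where
  regs : R → Word
  memory : ℕ → Word
  used : ℕ
  time : ℕ

/-- The initial state: everything is zero. -/
def RamState.init (R : Type) : RamState R :=
  ⟨fun _ => 0, fun _ => 0, 0, 0⟩

/-- Add `k` to the time. -/
def RamState.tick {R : Type} (s : RamState R) (k : ℕ) : RamState R :=
  { s with time := s.time + k }

/-- Write a word to a register. -/
def RamState.setReg {R : Type} [DecidableEq R] (s : RamState R) (r : R) (w : Word) : RamState R :=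
  { s with regs := Function.update s.regs r w }

/-- Write a word to a cell of the work memory. -/
def RamState.write {R : Type} (s : RamState R) (a : ℕ) (w : Word) : RamState R :=
  { s with memory := Function.update s.memory a w, used := max s.used (a + 1) }

namespace Expr

variable {R : Type}

/-- The value of an expression. -/
def eval (I : RamInput) (s : RamState R) : Expr R → Word
  | const w => w
  | reg r => s.regs r
  | mem a => s.memory (a.eval I s).toNat
  | add x y => x.eval I s + y.eval I s
  | sub x y => WithTop.map₂ (fun a b => a - b) (x.eval I s) (y.eval I s)
  | mul x y => WithTop.map₂ (fun a b => a * b) (x.eval I s) (y.eval I s)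
  | min x y => x.eval I s ⊓ y.eval I s
  | numBags => I.numBags
  | root => I.root
  | parent b => I.parent (b.eval I s)
  | child b i => I.child (b.eval I s) (i.eval I s)
  | bagSize b => I.bagSize (b.eval I s)
  | bagNode b i => I.bagNode (b.eval I s) (i.eval I s)
  | weight u v => I.weight (u.eval I s) (v.eval I s)

/-- The number of elementary operations (constants, register and memory reads, arithmetic
operations, input queries) in the evaluation of an expression. -/
def cost : Expr R → ℕ
  | const _ | reg _ | numBags | root => 1
  | mem x | parent x | bagSize x => x.cost + 1
  | add x y | sub x y | mul x y | min x y | child x y | bagNode x y | weight x y =>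
    x.cost + y.cost + 1

end Expr

namespace Prog

variable {R : Type}

/-- The execution of a program. Every assignment, every memory write, every comparison, the
initialisation of every loop and every loop iteration is charged one unit of time, on top of the
cost of the expressions it evaluates. -/
def exec [DecidableEq R] (I : RamInput) : Prog R → RamState R → RamState R
  | skip, s => s
  | assign r e, s => (s.setReg r (e.eval I s)).tick (e.cost + 1)
  | store a e, s => (s.write (a.eval I s).toNat (e.eval I s)).tick (a.cost + e.cost + 1)
  | seq p q, s => exec I q (exec I p s)
  | ifEq x y p q, s =>
    if x.eval I s = y.eval I s then exec I p (s.tick (x.cost + y.cost + 1))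
    else exec I q (s.tick (x.cost + y.cost + 1))
  | loop r e p, s =>
    (List.range (e.eval I s).toNat).foldl
      (fun t i => exec I p ((t.setReg r ((i : ℤ) : Word)).tick 1)) (s.tick (e.cost + 1))

/-- The nesting depth of the loops of a program. -/
def loopDepth : Prog R → ℕ
  | seq p q | ifEq _ _ p q => max p.loopDepth q.loopDepth
  | loop _ _ p => p.loopDepth + 1
  | _ => 0

/-- The state in which the program halts on input `I`. -/
def run [DecidableEq R] (P : Prog R) (I : RamInput) : RamState R :=
  P.exec I (RamState.init R)

/-- The value that the register `r` holds when the program halts. -/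
def output [DecidableEq R] (P : Prog R) (I : RamInput) (r : R) : Word :=
  (P.run I).regs r

/-- The running time of the program on input `I`. -/
def timeOn [DecidableEq R] (P : Prog R) (I : RamInput) : ℕ :=
  (P.run I).time

/-- The additional space of the program on input `I` in words: the registers, a counter and a
bound for each level of nested loops, and the used part of the work memory. -/
def spaceOn [DecidableEq R] [Fintype R] (P : Prog R) (I : RamInput) : ℕ :=
  Fintype.card R + 2 * P.loopDepth + (P.run I).used

end Prog

/-! ## The weighted graph and its tree decomposition as an input -/

/-- The word that stores an index. -/
def Word.ofFin {k : ℕ} (i : Fin k) : Word := ((i : ℤ) : WithTop ℤ)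

/-- The word that stores an optional index, `∞` being the null pointer. -/
def Word.ofOption {k : ℕ} : Option (Fin k) → Word
  | some i => Word.ofFin i
  | none => ⊤

/-- The index stored in a word, if any. -/
def Word.toFin? (k : ℕ) (w : Word) : Option (Fin k) :=
  if h : w ≠ ⊤ ∧ w.toNat < k then some ⟨w.toNat, h.2⟩ else none

open Classical in
/-- The read-only input for `G` and a listing of its tree decomposition. The weight of a pair that
is not an edge is `∞`, and so is the answer to a query that makes no sense (for instance the parent
of the root or the second child of a bag with one child); the size of a null bag is zero. -/
noncomputable def TreeDecomposition.Listing.toInput {n : ℕ} {G : WeightedDigraph n} {m : ℕ}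
    {D : TreeDecomposition G m} (L : D.Listing) : RamInput where
  numBags := ((m : ℤ) : WithTop ℤ)
  root := Word.ofFin D.root
  parent b := Word.ofOption ((b.toFin? m).bind L.parent)
  child b i := Word.ofOption ((b.toFin? m).bind fun j => (L.children j)[i.toNat]?)
  bagSize b := match b.toFin? m with
    | some j => (((L.nodes j).length : ℤ) : WithTop ℤ)
    | none => 0
  bagNode b i := Word.ofOption ((b.toFin? m).bind fun j => (L.nodes j)[i.toNat]?)
  weight u v := match u.toFin? n, v.toFin? n with
    | some x, some y => if G.Adj x y then (G.wt x y : WithTop ℤ) else ⊤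
    | _, _ => ⊤

/-! ## The algorithm `MinCycle`

It traverses the tree decomposition in post-order. The work memory is a stack of local distance
maps `LD_B : B × B → ℤ ∪ {∞}`, stored row by row with respect to the listing of `B`. When a bag is
examined, the maps of its children are on top of the stack. -/

namespace MinCycle

/-- The registers of `MinCycle`. -/
inductive Reg where
  /-- the output -/
  | c
  /-- the bag that is visited, and the bag that was visited just before it -/
  | cur | prev
  /-- the children of `cur` (null if they do not exist), and the next bag to descend to, if any -/
  | ch1 | ch2 | next
  /-- the sizes of `cur`, `ch1` and `ch2` -/
  | k | k1 | k2
  /-- the first free address of the stack, and the addresses of the maps of `ch1` and `ch2` -/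
  | sp | base1 | base2
  /-- loop variables -/
  | t | i | j | p | q | r
  /-- auxiliary values -/
  | val | isRoot
  deriving DecidableEq

instance : Fintype Reg where
  elems := {.c, .cur, .prev, .ch1, .ch2, .next, .k, .k1, .k2, .sp, .base1, .base2,
    .t, .i, .j, .p, .q, .r, .val, .isRoot}
  complete x := by cases x <;> decide

open Reg

/-- A numeral as an expression. -/
abbrev lit (z : ℤ) : Expr Reg := .const (z : WithTop ℤ)

/-- The address of entry `(x, y)` of a map with `d` rows and columns that starts at `base`. -/
abbrev entry (base d x y : Reg) : Expr Reg :=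
  (base : Expr Reg) + (x : Expr Reg) * (d : Expr Reg) + (y : Expr Reg)

/-- `val ← min(val, LD_child(u, v))`, where `u` and `v` are the nodes number `i` and `j` of `cur`.
Nothing happens if `u` or `v` does not belong to the bag `child`. -/
def minWithChild (child d base : Reg) : Prog Reg :=
  .loop p d <| .loop q d <|
    .ifEq (.bagNode child p) (.bagNode cur i)
      (.ifEq (.bagNode child q) (.bagNode cur j)
        (.assign val (.min val (.mem (entry base d p q))))
        .skip)
      .skip

/-- `LD_cur(u, v) ← min(LD_ch1(u, v), LD_ch2(u, v), wt(u, v))` for all `u, v` in `cur`. The new map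
is written at the top of the stack. -/
def combine : Prog Reg :=
  .loop i k <| .loop j k <| .block [
    .assign val (.weight (.bagNode cur i) (.bagNode cur j)),
    minWithChild ch1 k1 base1,
    minWithChild ch2 k2 base2,
    .store (entry sp k i j) val]

/-- Copy a map with `k` rows and columns from the top of the stack to `base1`. -/
def moveDown : Prog Reg :=
  .loop i ((k : Expr Reg) * (k : Expr Reg)) <|
    .store ((base1 : Expr Reg) + (i : Expr Reg)) (.mem ((sp : Expr Reg) + (i : Expr Reg)))

/-- `isRoot ← 1` if `cur` is the root bag of its node `x` number `r`, that is, if `x` does not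
belong to the parent of `cur`, and `isRoot ← 0` otherwise. -/
def testRoot : Prog Reg :=
  .block [
    .assign isRoot (lit 1),
    .loop p (.bagSize (.parent cur)) <|
      .ifEq (.bagNode (.parent cur) p) (.bagNode cur r) (.assign isRoot (lit 0)) .skip]

/-- `LD'(u, v) ← min(LD_cur(u, v), LD_cur(u, x) + LD_cur(x, v))` for all `u, v` in `cur`, where `x`
is the node number `r` of `cur`; then `LD_cur ← LD'` and `c ← min(c, LD_cur(x, x))`. -/
def shorten : Prog Reg :=
  .block [
    .loop i k <| .loop j k <|
      .store (entry sp k i j)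
        (.min (.mem (entry base1 k i j))
          ((.mem (entry base1 k i r) : Expr Reg) + (.mem (entry base1 k r j) : Expr Reg))),
    moveDown,
    .assign c (.min c (.mem (entry base1 k r r)))]

/-- Examine the bag `cur`: replace the maps of its children on the stack by the map of `cur`. -/
def examine : Prog Reg :=
  .block [
    .assign k (.bagSize cur),
    .assign k1 (.bagSize ch1),
    .assign k2 (.bagSize ch2),
    .assign base2 ((sp : Expr Reg) - (k2 : Expr Reg) * (k2 : Expr Reg)),
    .assign base1 ((base2 : Expr Reg) - (k1 : Expr Reg) * (k1 : Expr Reg)),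
    combine,
    moveDown,
    .assign sp ((base1 : Expr Reg) + (k : Expr Reg) * (k : Expr Reg)),
    .loop r k <| .block [
      testRoot,
      .ifEq isRoot (lit 1) shorten .skip]]

/-- One move of the depth-first traversal: descend to the next child of `cur` that has not been
visited yet; if there is none, examine `cur` and go back to its parent. -/
def move : Prog Reg :=
  .block [
    .assign ch1 (.child cur (lit 0)),
    .assign ch2 (.child cur (lit 1)),
    .ifEq prev (.parent cur)
      (.assign next ch1)
      (.ifEq prev ch1 (.assign next ch2) (.assign next (.const ⊤))),
    .ifEq next (.const ⊤)
      (.block [examine, .assign prev cur, .assign cur (.parent cur)])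
      (.block [.assign prev cur, .assign cur next])]

/-- The algorithm `MinCycle`. A traversal of a tree with `m` bags consists of `2m - 1` moves. -/
def program : Prog Reg :=
  .block [
    .assign c (.const ⊤),
    .assign sp (lit 0),
    .assign cur .root,
    .assign prev (.const ⊤),
    .loop t (lit 2 * (.numBags : Expr Reg) - lit 1) move]

end MinCycle

/-! A local distance map is controlled from two sides. Its finite entries are weights of actual
walks (`IsRealized`), and each entry is at most the weight of every walk between its two nodes whose
interior nodes are distinct and occur only in bags below the current one (`IsShort` with
`ownNodes`). The tree structure enters through one fact: a node below a bag `B` but not in `B`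
occurs below exactly one child of `B`, and a walk with no interior node in `B` cannot pass from the
subtree of one child to that of another. So the minimum of the edge weights and the children's maps
is already short for own nodes outside `B` (`isShort_of_children`). The own nodes in `B` are those
missing from its parent; adding them one by one is the Floyd–Warshall step (`IsShort.relax`). A
simple cycle is caught on the diagonal when the last of its nodes is eliminated
(`CoversCycles.relax`). Every node is an own node of the root, so the output is at most every simple
cycle weight.

Conversely, the output is `∞` or the weight of a closed walk, and closed walks decompose into simple
cycles (`HasWalk.closed_induction`). If no cycle is negative, a sum of simple cycle weights is at
least the smallest one (`eq_minCycleWeight`). Otherwise a closed walk with `l` edges has at most `l`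
parts and weighs at least `c* * l` (`approx_minCycleWeight`). An elimination at most doubles the
number of edges, a bag eliminates at most `K = width + 1` nodes, and there are at most `H + 1`
levels, where `H` bounds the levels. This gives `l = 2 ^ (K * (H + 1))`, polynomial in `n` for
logarithmic `H`.

For space, the stack keeps at most one finished sibling map for each level above the current bag, so
a bag's map starts at an address of at most `level * K²`. For time, there are `2m - 1` moves, each
bounded by a constant read off the program text (`exec_time_le`). Loop invariants tie the program to
this argument; `visit` combines them along the depth-first traversal. -/

/-! ## Walks with given interior nodes -/

namespace WeightedDigraph

variable {n : ℕ} {G : WeightedDigraph n}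

/-- There is a walk from `u` to `v` of weight `w` whose interior nodes are listed by `ys`. -/
inductive HasWalk (G : WeightedDigraph n) : Fin n → List (Fin n) → Fin n → ℤ → Prop
  | edge {u v} : G.Adj u v → HasWalk G u [] v (G.wt u v)
  | cons {u y v ys w} : G.Adj u y → HasWalk G y ys v w → HasWalk G u (y :: ys) v (G.wt u y + w)

theorem HasWalk.append {u x v : Fin n} {ys zs : List (Fin n)} {w w' : ℤ}
    (h : G.HasWalk u ys x w) (h' : G.HasWalk x zs v w') :
    G.HasWalk u (ys ++ x :: zs) v (w + w') := by
  induction h with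
  | edge h => exact .cons h h'
  | cons h _ ih =>
    rw [add_assoc]
    exact .cons h (ih h')

theorem HasWalk.split {u x v : Fin n} {ys zs : List (Fin n)} {w : ℤ}
    (h : G.HasWalk u (ys ++ x :: zs) v w) :
    ∃ w₁ w₂, w = w₁ + w₂ ∧ G.HasWalk u ys x w₁ ∧ G.HasWalk x zs v w₂ := by
  induction ys generalizing u w with
  | nil =>
    cases h with
    | cons h h' => exact ⟨_, _, rfl, .edge h, h'⟩
  | cons y ys ih =>
    cases h with
    | cons h h' =>
      obtain ⟨w₁, w₂, rfl, h₁, h₂⟩ := ih h'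
      exact ⟨_, w₂, (add_assoc _ _ _).symm, .cons h h₁, h₂⟩

/-- A closed walk can be started at any of its nodes. -/
theorem HasWalk.rotate {u x : Fin n} {ys zs : List (Fin n)} {w : ℤ}
    (h : G.HasWalk u (ys ++ x :: zs) u w) : G.HasWalk x (zs ++ u :: ys) x w := by
  obtain ⟨w₁, w₂, rfl, h₁, h₂⟩ := h.split
  rw [add_comm]
  exact h₂.append h₁

/-- Every closed walk decomposes into simple cycles. -/
theorem HasWalk.closed_induction {P : ℕ → ℤ → Prop}
    (simple : ∀ u ys w, G.HasWalk u ys u w → (u :: ys).Nodup → P (ys.length + 1) w)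
    (add : ∀ k k' w w', P k w → P k' w' → P (k + k') (w + w')) {u : Fin n} {ys : List (Fin n)}
    {w : ℤ} (h : G.HasWalk u ys u w) : P (ys.length + 1) w := by
  induction hl : ys.length using Nat.strong_induction_on generalizing u ys w with
  | _ l ih =>
  subst hl
  by_cases hn : (u :: ys).Nodup
  · exact simple u ys w h hn
  rw [List.nodup_cons, not_and_or, not_not] at hn
  rcases hn with hu | hn
  -- The base node recurs in the interior, so the walk is a concatenation of two shorter closed
  -- walks at it.
  · obtain ⟨a, b, rfl⟩ := List.append_of_mem hu
    obtain ⟨w₁, w₂, rfl, h₁, h₂⟩ := h.split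
    have := add _ _ _ _ (ih a.length (by grind) h₁ rfl) (ih b.length (by grind) h₂ rfl)
    convert this using 1
    simp
    omega
  · obtain ⟨x, hx⟩ : ∃ x, ¬ ys.count x ≤ 1 := by
      by_contra! hc
      exact hn (List.nodup_iff_count_le_one.2 hc)
    obtain ⟨a, b, rfl⟩ := List.append_of_mem (List.count_pos_iff.1 (by omega : 0 < ys.count x))
    obtain ⟨w₁, w₂, rfl, h₁, h₂⟩ := h.split
    have hb : x ∈ a ++ b := by
      apply List.count_pos_iff.1
      simp only [List.count_append, List.count_cons_self] at hx ⊢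
      omega
    -- The loop between two occurrences of `x` is cut out and the rest is closed up at `u`. The two
    -- cases say on which side of the chosen occurrence the other one lies.
    rcases List.mem_append.1 hb with ha | hb
    · obtain ⟨c, d, rfl⟩ := List.append_of_mem ha
      obtain ⟨w₃, w₄, rfl, h₃, h₄⟩ := h₁.split
      have := add _ _ _ _ (ih _ (by grind) (h₃.append h₂) rfl)
        (ih d.length (by grind) h₄ rfl)
      convert this using 1
      · simp
        omega
      · ring
    · obtain ⟨c, d, rfl⟩ := List.append_of_mem hb
      obtain ⟨w₃, w₄, rfl, h₃, h₄⟩ := h₂.split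
      have := add _ _ _ _ (ih _ (by grind) (h₁.append h₄) rfl)
        (ih c.length (by grind) h₃ rfl)
      convert this using 1
      · simp
        omega
      · ring

theorem HasWalk.pathWeight {u v : Fin n} {ys : List (Fin n)} {w : ℤ} (h : G.HasWalk u ys v w) :
    G.IsPath (u :: (ys ++ [v])) ∧ G.pathWeight (u :: (ys ++ [v])) = w := by
  induction h with
  | edge h => simpa [IsPath, WeightedDigraph.pathWeight] using h
  | cons h _ ih =>
    refine ⟨⟨by simp, ?_⟩, ?_⟩
    · simpa using ⟨h, ih.1.2⟩
    · rw [List.cons_append, WeightedDigraph.pathWeight, ih.2]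

theorem hasWalk_of_isPath {u v : Fin n} {ys : List (Fin n)} (h : G.IsPath (u :: (ys ++ [v]))) :
    G.HasWalk u ys v (G.pathWeight (u :: (ys ++ [v]))) := by
  induction ys generalizing u with
  | nil =>
    have := h.2
    simp only [List.nil_append, List.isChain_cons_cons] at this
    simpa [pathWeight] using HasWalk.edge this.1
  | cons y ys ih =>
    have := h.2
    simp only [List.cons_append, List.isChain_cons_cons] at this
    rw [List.cons_append, pathWeight]
    exact .cons this.1 (ih ⟨by simp, this.2⟩)

theorem IsCycle.hasWalk {p : List (Fin n)} (h : G.IsCycle p) :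
    ∃ u ys, p = u :: (ys ++ [u]) ∧ G.HasWalk u ys u (G.pathWeight p) := by
  obtain ⟨hp, hl, he⟩ := h
  match p with
  | [] => simp at hl
  | [_] => simp at hl
  | u :: v :: q =>
    obtain ⟨ys, z, hz⟩ : ∃ ys z, v :: q = ys ++ [z] :=
      ⟨_, _, (List.dropLast_append_getLast (List.cons_ne_nil v q)).symm⟩
    rw [hz] at hp he ⊢
    have : u = z := by
      rw [List.head?_cons, ← List.cons_append, List.getLast?_append] at he
      simpa using he
    subst this
    exact ⟨u, ys, rfl, hasWalk_of_isPath hp⟩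

theorem HasWalk.isCycle {u : Fin n} {ys : List (Fin n)} {w : ℤ} (h : G.HasWalk u ys u w) :
    G.IsCycle (u :: (ys ++ [u])) :=
  ⟨h.pathWeight.1, by simp, by
    rw [List.head?_cons, ← List.cons_append, List.getLast?_append]
    rfl⟩

/-! ### Simple cycles and the optimal weight -/

theorem mem_simpleCycleWeights {z : WithTop ℤ} :
    z ∈ G.simpleCycleWeights ↔
      ∃ u ys w, G.HasWalk u ys u w ∧ (u :: ys).Nodup ∧ z = ((w : ℤ) : WithTop ℤ) := by
  constructor
  · rintro ⟨p, ⟨hc, hn⟩, rfl⟩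
    obtain ⟨u, ys, hp, h⟩ := hc.hasWalk
    refine ⟨u, ys, _, h, ?_, rfl⟩
    rw [hp] at hn
    exact (List.perm_append_singleton u ys).nodup_iff.1 hn
  · rintro ⟨u, ys, w, h, hn, rfl⟩
    refine ⟨_, ⟨h.isCycle, ?_⟩, by rw [h.pathWeight.2]⟩
    exact (List.perm_append_singleton u ys).nodup_iff.2 hn

/-- `z` is `∞` or the weight of a closed walk with at most `l` edges. -/
def IsClosedWalkWeight (G : WeightedDigraph n) (l : ℕ) (z : WithTop ℤ) : Prop :=
  z = ⊤ ∨ ∃ u ys w, G.HasWalk u ys u w ∧ ys.length + 1 ≤ l ∧ z = (w : ℤ)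

/-- A closed walk contains a simple cycle, so the infimum is over a nonempty finite set and is
attained. -/
theorem exists_minCycleWeight_eq {u : Fin n} {ys : List (Fin n)} {w : ℤ}
    (h : G.HasWalk u ys u w) :
    ∃ c : ℤ, G.minCycleWeight = c ∧ c ∈ {c : ℤ | (c : WithTop ℤ) ∈ G.simpleCycleWeights} ∧
      ∀ u ys w, G.HasWalk u ys u w → (u :: ys).Nodup → c ≤ w := by
  have hne : G.simpleCycleWeights.Nonempty := by
    refine h.closed_induction (P := fun _ _ => G.simpleCycleWeights.Nonempty) ?_ ?_
    · intro u ys w h hn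
      exact ⟨_, mem_simpleCycleWeights.2 ⟨u, ys, w, h, hn, rfl⟩⟩
    · exact fun _ _ _ _ h _ => h
  have hl := G.isLeast_minCycleWeight hne
  obtain ⟨u, ys, w, hw, hn, he⟩ := mem_simpleCycleWeights.1 hl.1
  refine ⟨w, he, ?_, fun u' ys' w' hw' hn' => ?_⟩
  · rw [Set.mem_ofPred_eq, ← he]
    exact hl.1
  · have := hl.2 (mem_simpleCycleWeights.2 ⟨u', ys', w', hw', hn', rfl⟩)
    rw [he] at this
    exact_mod_cast this

/-- A closed walk is a sum of simple cycles of nonnegative weight, so it weighs at least as much as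
the cheapest of them. The length bound `l` plays no role here. -/
theorem eq_minCycleWeight {l : ℕ} {z : WithTop ℤ} (hG : ¬ G.HasNegativeCycle)
    (hz : G.IsClosedWalkWeight l z)
    (hle : ∀ u ys w, G.HasWalk u ys u w → (u :: ys).Nodup → z ≤ (w : ℤ)) :
    z = G.minCycleWeight := by
  apply le_antisymm
  · rcases G.simpleCycleWeights.eq_empty_or_nonempty with h0 | h0
    · rw [G.minCycleWeight_eq_top h0]
      exact le_top
    · obtain ⟨u, ys, w, h, hn, he⟩ := mem_simpleCycleWeights.1 (G.isLeast_minCycleWeight h0).1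
      exact he ▸ hle u ys w h hn
  · rcases hz with rfl | ⟨u, ys, w, h, -, rfl⟩
    · exact le_top
    · obtain ⟨c, hc, hmem, hmin⟩ := exists_minCycleWeight_eq h
      rw [hc]
      have h0 : 0 ≤ c := by
        obtain ⟨u, ys, w, h, -, he⟩ := mem_simpleCycleWeights.1 hmem
        by_contra! hlt
        refine hG ⟨_, h.isCycle, ?_⟩
        rw [h.pathWeight.2]
        have : c = w := by exact_mod_cast he
        omega
      -- The lower bound `c` survives addition of two closed walks only because `0 ≤ c`.
      have : c ≤ w := h.closed_induction (P := fun _ w => c ≤ w) hmin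
        (fun _ _ _ _ h h' => by omega)
      exact_mod_cast this

/-- Each simple cycle in the decomposition of the closed walk uses an edge and weighs at least the
optimum, which is negative. Hence the weight of the walk cannot drop below the optimum times its
number of edges. -/
theorem approx_minCycleWeight {l : ℕ} {z : WithTop ℤ} (hG : G.HasNegativeCycle)
    (hz : G.IsClosedWalkWeight l z)
    (hle : ∀ u ys w, G.HasWalk u ys u w → (u :: ys).Nodup → z ≤ (w : ℤ)) :
    z ≤ G.minCycleWeight ∧ ∃ c cstar : ℤ, z = c ∧ G.minCycleWeight = cstar ∧
      |cstar| ≤ |c| ∧ |c| ≤ |cstar| * l := by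
  obtain ⟨p, hp, hneg⟩ := hG
  obtain ⟨u, ys, -, h⟩ := hp.hasWalk
  obtain ⟨c, hc, hmem, hmin⟩ := exists_minCycleWeight_eq h
  have hc0 : c < 0 := by
    by_contra! h0
    have : 0 ≤ G.pathWeight p := h.closed_induction (P := fun _ w => 0 ≤ w)
      (fun u ys w h hn => h0.trans (hmin u ys w h hn)) (fun _ _ _ _ h h' => by omega)
    omega
  have hzc : z ≤ c := by
    obtain ⟨u, ys, w, h, hn, he⟩ := mem_simpleCycleWeights.1 hmem
    rw [he]
    exact hle u ys w h hn
  refine ⟨hc ▸ hzc, ?_⟩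
  rcases hz with rfl | ⟨u', ys', w, hw, hl, rfl⟩
  · simp at hzc
  have hwc : w ≤ c := by exact_mod_cast hzc
  refine ⟨w, c, rfl, hc, ?_, ?_⟩
  · rw [abs_of_neg hc0, abs_of_nonpos (by omega)]
    omega
  -- For a simple cycle, `c` times its positive edge count is at most `c` since `c < 0`. Both sides
  -- are additive over the decomposition.
  · have : c * ((ys'.length + 1 : ℕ) : ℤ) ≤ w := by
      refine hw.closed_induction (P := fun k w => c * (k : ℤ) ≤ w) ?_ ?_
      · intro u ys w h hn
        have := hmin u ys w h hn
        push_cast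
        nlinarith [(by positivity : (0 : ℤ) ≤ ys.length)]
      · intro k k' w w' h h'
        push_cast
        linarith
    rw [abs_of_neg hc0, abs_of_nonpos (by omega)]
    have hl' : ((ys'.length + 1 : ℕ) : ℤ) ≤ l := by exact_mod_cast hl
    nlinarith

end WeightedDigraph

/-! ## Subtrees of a tree decomposition -/

namespace TreeDecomposition

variable {n : ℕ} {G : WeightedDigraph n} {m : ℕ} (D : TreeDecomposition G m)

/-- The bags of the subtree rooted at `i`. -/
def subtree (i : Fin m) : Set (Fin m) :=
  {j | Relation.ReflTransGen D.IsChild i j}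

/-- The nodes that occur only in bags of the subtree rooted at `i`. -/
def ownNodes (i : Fin m) : Set (Fin n) :=
  {x | ∀ j, x ∈ D.bag j → j ∈ D.subtree i}

variable {D}

theorem IsChild.level_eq {i j : Fin m} (h : D.IsChild i j) : D.level j = D.level i + 1 :=
  h.2

theorem self_mem_subtree (i : Fin m) : i ∈ D.subtree i :=
  .refl

theorem level_le_of_mem_subtree {i j : Fin m} (h : j ∈ D.subtree i) : D.level i ≤ D.level j := by
  induction h with
  | refl => exact le_rfl
  | tail _ h ih => rw [h.level_eq]; omega

theorem IsChild.notMem_subtree {i j : Fin m} (h : D.IsChild i j) : i ∉ D.subtree j := by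
  intro hi
  have := level_le_of_mem_subtree hi
  rw [h.level_eq] at this
  omega

theorem isChild_or_isChild {i j : Fin m} (h : D.tree.Adj i j) : D.IsChild i j ∨ D.IsChild j i := by
  rcases D.isTree.dist_eq_dist_add_one_of_adj D.root h with h' | h'
  · exact .inr ⟨h.symm, h'⟩
  · exact .inl ⟨h, h'⟩

/-- The second bag on a shortest path from `i` to the root is nearer to the root, so it is the
parent of `i`; induction on the level finishes. -/
theorem mem_subtree_root (i : Fin m) : i ∈ D.subtree D.root := by
  suffices ∀ (l : ℕ) (i : Fin m), D.level i = l → i ∈ D.subtree D.root from this _ i rfl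
  intro l
  induction l with
  | zero =>
    intro i hi
    rw [D.isTree.connected.dist_eq_zero_iff.1 hi]
    exact self_mem_subtree _
  | succ l ih =>
    intro i hi
    obtain ⟨p, hp⟩ := D.isTree.connected.exists_walk_length_eq_dist i D.root
    rw [SimpleGraph.dist_comm] at hp
    cases p with
    | nil => exact self_mem_subtree _
    | @cons _ j _ h p =>
      rcases isChild_or_isChild h with h' | h'
      · have h1 := SimpleGraph.dist_le p
        rw [SimpleGraph.dist_comm] at h1
        have h2 := h'.level_eq
        rw [SimpleGraph.Walk.length_cons] at hp
        simp only [level] at h2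
        omega
      · exact (ih j (by have := h'.level_eq; omega)).tail h'

/-- The only edge of the tree that leaves a subtree joins its root to the parent of its root. -/
theorem adj_leaving {i j k : Fin m} (h : D.tree.Adj j k) (hj : j ∈ D.subtree i)
    (hk : k ∉ D.subtree i) : j = i ∧ D.IsChild k i := by
  rcases isChild_or_isChild h with h' | h'
  · exact absurd (hj.tail h') hk
  · rcases Relation.ReflTransGen.cases_tail hj with e | ⟨a, ha, haj⟩
    · subst e
      exact ⟨rfl, h'⟩
    · rw [D.isChild_unique haj h'] at ha
      exact absurd ha hk

/-- A node that occurs both inside and outside of a subtree occurs in its root and in the parent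
of its root. -/
theorem mem_bag_of_leaving {i j k : Fin m} {x : Fin n} (hj : j ∈ D.subtree i)
    (hk : k ∉ D.subtree i) (hxj : x ∈ D.bag j) (hxk : x ∈ D.bag k) :
    x ∈ D.bag i ∧ ∃ p, D.IsChild p i ∧ x ∈ D.bag p := by
  classical
  obtain ⟨p, hp⟩ := (D.isTree.connected.preconnected j k).exists_isPath
  -- The tree path must leave the subtree somewhere, and it can do so only along the edge from `i`
  -- to its parent. Contiguity then puts `x` into both ends of that edge.
  obtain ⟨d, hd, h1, h2⟩ := p.exists_boundary_dart _ hj hk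
  obtain ⟨e, hc⟩ := adj_leaving d.adj h1 h2
  have key : ∀ a ∈ p.support, x ∈ D.bag a := fun a ha =>
    D.contiguous j k a p hp ha (Finset.mem_inter.2 ⟨hxj, hxk⟩)
  refine ⟨e ▸ key _ (p.dart_fst_mem_support_of_mem_darts hd), _, hc,
    key _ (p.dart_snd_mem_support_of_mem_darts hd)⟩

theorem mem_ownNodes_root (x : Fin n) : x ∈ D.ownNodes D.root :=
  fun _ _ => mem_subtree_root _

/-- A node of `bag i` that does not belong to the parent of `i` occurs below `i` only. -/
theorem mem_ownNodes_of_mem_bag {i : Fin m} {x : Fin n} (hx : x ∈ D.bag i)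
    (hp : ∀ p, D.IsChild p i → x ∉ D.bag p) : x ∈ D.ownNodes i := by
  intro j hj
  by_contra hji
  obtain ⟨-, p, hp', hxp⟩ := mem_bag_of_leaving (self_mem_subtree i) hji hx hj
  exact hp p hp' hxp

theorem notMem_parent_of_mem_ownNodes {i p : Fin m} {x : Fin n} (hx : x ∈ D.ownNodes i)
    (hp : D.IsChild p i) : x ∉ D.bag p :=
  fun h => hp.notMem_subtree (hx p h)

/-- A node below `i` that does not occur in `bag i` occurs only below one child of `i`. -/
theorem exists_child_mem_ownNodes {i : Fin m} {x : Fin n} (hx : x ∈ D.ownNodes i)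
    (hxi : x ∉ D.bag i) : ∃ j, D.IsChild i j ∧ x ∈ D.ownNodes j := by
  obtain ⟨k, hk⟩ := D.node_covered x
  rcases Relation.ReflTransGen.cases_head (hx k hk) with e | ⟨j, hj, hjk⟩
  · exact absurd (e ▸ hk) hxi
  · refine ⟨j, hj, fun k' hk' => ?_⟩
    by_contra hk'j
    obtain ⟨-, p, hp, hxp⟩ := mem_bag_of_leaving hjk hk'j hk hk'
    exact hxi (D.isChild_unique hp hj ▸ hxp)

/-- A neighbour of a node that occurs only below the child `j` of `i` occurs only below `j` as
well, or it belongs to the bag `i`. -/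
theorem adj_mem_ownNodes {i j : Fin m} {x y : Fin n} (hij : D.IsChild i j)
    (hxy : G.Adj x y ∨ G.Adj y x) (hx : x ∈ D.ownNodes j) (hy : y ∉ D.bag i) :
    y ∈ D.ownNodes j := by
  obtain ⟨k, hxk, hyk⟩ : ∃ k, x ∈ D.bag k ∧ y ∈ D.bag k := by
    rcases hxy with h | h
    · exact D.edge_covered _ _ h
    · obtain ⟨k, h1, h2⟩ := D.edge_covered _ _ h
      exact ⟨k, h2, h1⟩
  intro k' hk'
  by_contra hk'j
  obtain ⟨-, p, hp, hyp⟩ := mem_bag_of_leaving (hx k hxk) hk'j hyk hk'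
  exact hy (D.isChild_unique hp hij ▸ hyp)

/-- If a neighbour of a node that occurs only below the child `j` of `i` belongs to the bag `i`,
then it belongs to the bag `j`. -/
theorem adj_mem_bag {i j : Fin m} {x y : Fin n} (hij : D.IsChild i j)
    (hxy : G.Adj x y ∨ G.Adj y x) (hx : x ∈ D.ownNodes j) (hy : y ∈ D.bag i) :
    y ∈ D.bag j := by
  obtain ⟨k, hxk, hyk⟩ : ∃ k, x ∈ D.bag k ∧ y ∈ D.bag k := by
    rcases hxy with h | h
    · exact D.edge_covered _ _ h
    · obtain ⟨k, h1, h2⟩ := D.edge_covered _ _ h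
      exact ⟨k, h2, h1⟩
  exact (mem_bag_of_leaving (hx k hxk) hij.notMem_subtree hyk hy).1

/-- A walk that avoids `bag i` except at its ends and starts below the child `j` of `i` stays below
`j`, and its end, if it is in `bag i`, is in `bag j`. -/
theorem hasWalk_below_child {i j : Fin m} (hij : D.IsChild i j) {u v : Fin n} {ys : List (Fin n)}
    {w : ℤ} (h : G.HasWalk u ys v w) (hu : u ∈ D.ownNodes j) (hys : ∀ y ∈ ys, y ∉ D.bag i) :
    (∀ y ∈ ys, y ∈ D.ownNodes j) ∧ (v ∈ D.bag i → v ∈ D.bag j) := by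
  induction h with
  | edge h => exact ⟨by simp, adj_mem_bag hij (.inl h) hu⟩
  | @cons u y v ys w h _ ih =>
    have hy := adj_mem_ownNodes hij (.inl h) hu (hys y (by simp))
    obtain ⟨h1, h2⟩ := ih hy fun z hz => hys z (by simp [hz])
    refine ⟨fun z hz => ?_, h2⟩
    rcases List.mem_cons.1 hz with rfl | hz
    · exact hy
    · exact h1 z hz

theorem subtree_eq_insert (i : Fin m) :
    D.subtree i = insert i (⋃ j ∈ {j | D.IsChild i j}, D.subtree j) := by
  ext k
  simp only [Set.mem_insert_iff, Set.mem_iUnion]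
  constructor
  · intro h
    rcases Relation.ReflTransGen.cases_head h with e | ⟨j, hj, hjk⟩
    · exact .inl e.symm
    · exact .inr ⟨j, hj, hjk⟩
  · rintro (rfl | ⟨j, hj, hjk⟩)
    · exact self_mem_subtree _
    · exact .head hj hjk

/-- Parents are unique, so two descending paths to a common bag share their last edge. Stripping
common edges ends at `j` or `j'`, where one child would lie above its own parent. -/
theorem subtree_disjoint {i j j' : Fin m} (h : D.IsChild i j) (h' : D.IsChild i j')
    (hne : j ≠ j') : Disjoint (D.subtree j) (D.subtree j') := by
  have key : ∀ k, k ∈ D.subtree j → k ∈ D.subtree j' → False := by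
    intro k hk
    induction hk with
    | refl =>
      intro hk'
      rcases Relation.ReflTransGen.cases_tail hk' with e | ⟨a, ha, haj⟩
      · exact hne e
      · exact h'.notMem_subtree (D.isChild_unique haj h ▸ ha)
    | @tail b c hb hbc ih =>
      intro hk'
      rcases Relation.ReflTransGen.cases_tail hk' with e | ⟨a, ha, hac⟩
      · subst e
        exact h.notMem_subtree (D.isChild_unique hbc h' ▸ hb)
      · exact ih (D.isChild_unique hac hbc ▸ ha)
  exact Set.disjoint_left.2 fun k => key k

theorem ncard_subtree_root : (D.subtree D.root).ncard = m := by
  rw [show D.subtree D.root = Set.univ from Set.eq_univ_of_forall mem_subtree_root,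
    Set.ncard_univ, Nat.card_fin]

namespace Listing

variable (L : D.Listing)

/-- The number of bags of the subtree rooted at `i` in terms of the subtrees of its children. -/
theorem ncard_subtree (i : Fin m) :
    (D.subtree i).ncard = 1 + ((L.children i).map fun j => (D.subtree j).ncard).sum := by
  classical
  have hs : {j | D.IsChild i j} = {j | j ∈ L.children i} := by
    ext j
    exact (L.mem_children i j).symm
  rw [subtree_eq_insert, hs, Set.ncard_insert_of_notMem _ (Set.toFinite _), add_comm]
  · congr 1
    have hc : ∀ j ∈ L.children i, D.IsChild i j := fun j => (L.mem_children i j).1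
    have hn := L.children_nodup i
    generalize L.children i = l at hc hn
    induction l with
    | nil => simp
    | cons a l ih =>
      rw [List.nodup_cons] at hn
      have hU : (⋃ j ∈ {j | j ∈ a :: l}, D.subtree j)
          = D.subtree a ∪ ⋃ j ∈ {j | j ∈ l}, D.subtree j := by
        ext k
        simp
      rw [hU, Set.ncard_union_eq _ (Set.toFinite _) (Set.toFinite _),
        ih (fun j hj => hc j (by simp [hj])) hn.2, List.map_cons, List.sum_cons]
      simp only [Set.disjoint_iUnion_right]
      intro j hj
      exact subtree_disjoint (hc a (by simp)) (hc j (by simpa using .inr hj))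
        (fun e => hn.1 (e ▸ hj))
  · simp only [Set.mem_iUnion, not_exists]
    exact fun j hj => ((L.mem_children i j).1 hj).notMem_subtree

end Listing

end TreeDecomposition

/-! ## Local distance maps -/

/-- The map obtained from `f` when walks through `x` are taken into account. -/
def relax {n : ℕ} (x : Fin n) (f : Fin n → Fin n → WithTop ℤ) (u v : Fin n) : WithTop ℤ :=
  f u v ⊓ (f u x + f x v)

namespace WeightedDigraph

variable {n : ℕ} {G : WeightedDigraph n} {B S : Set (Fin n)} {l : ℕ}
  {f : Fin n → Fin n → WithTop ℤ} {c : WithTop ℤ}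

/-- Every finite value of `f` on `B` is the weight of a walk with at most `l` edges. -/
def IsRealized (G : WeightedDigraph n) (B : Set (Fin n)) (l : ℕ) (f : Fin n → Fin n → WithTop ℤ) :
    Prop :=
  ∀ u ∈ B, ∀ v ∈ B, f u v = ⊤ ∨ ∃ ys w, G.HasWalk u ys v w ∧ ys.length + 1 ≤ l ∧ f u v = (w : ℤ)

/-- On `B`, the map `f` is at most the weight of every walk with distinct interior nodes in `S`. -/
def IsShort (G : WeightedDigraph n) (B S : Set (Fin n)) (f : Fin n → Fin n → WithTop ℤ) : Prop :=
  ∀ u ∈ B, ∀ v ∈ B, ∀ ys w, G.HasWalk u ys v w → ys.Nodup → (∀ y ∈ ys, y ∈ S) →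
    f u v ≤ (w : ℤ)

/-- `c` is at most the weight of every simple cycle in `S`. -/
def CoversCycles (G : WeightedDigraph n) (S : Set (Fin n)) (c : WithTop ℤ) : Prop :=
  ∀ x ys w, G.HasWalk x ys x w → (x :: ys).Nodup → (∀ y ∈ x :: ys, y ∈ S) → c ≤ (w : ℤ)

theorem IsClosedWalkWeight.inf {c' : WithTop ℤ} (h : G.IsClosedWalkWeight l c)
    (h' : G.IsClosedWalkWeight l c') : G.IsClosedWalkWeight l (c ⊓ c') := by
  rcases min_choice c c' with e | e <;> rw [e] <;> assumption

theorem IsRealized.diag (h : G.IsRealized B l f) {x : Fin n} (hx : x ∈ B) :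
    G.IsClosedWalkWeight l (f x x) := by
  rcases h x hx x hx with h | ⟨ys, w, h⟩
  · exact .inl h
  · exact .inr ⟨x, ys, w, h⟩

theorem IsRealized.mono {l' : ℕ} (h : G.IsRealized B l f) (hl : l ≤ l') :
    G.IsRealized B l' f := by
  intro u hu v hv
  rcases h u hu v hv with h | ⟨ys, w, h, hy, e⟩
  · exact .inl h
  · exact .inr ⟨ys, w, h, hy.trans hl, e⟩

/-- The new value comes from one old walk or from the concatenation of two, which is why the edge
bound doubles. The concatenation may repeat nodes; only its length is controlled. -/
theorem IsRealized.relax (h : G.IsRealized B l f) {x : Fin n} (hx : x ∈ B) :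
    G.IsRealized B (2 * l) (relax x f) := by
  intro u hu v hv
  unfold _root_.relax
  rcases min_choice (f u v) (f u x + f x v) with e | e <;> rw [e]
  · exact h.mono (by omega) u hu v hv
  · rcases h u hu x hx with h1 | ⟨ys, w, h1, hy, e1⟩
    · left; rw [h1, WithTop.top_add]
    rcases h x hx v hv with h2 | ⟨zs, w', h2, hz, e2⟩
    · left; rw [h2, WithTop.add_top]
    right
    refine ⟨_, _, h1.append h2, ?_, ?_⟩
    · simp
      omega
    · rw [e1, e2]
      rfl

/-- The Floyd–Warshall step: since the interior nodes are distinct, a walk through `x` meets it once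
there and splits into two walks with interior in `S`. -/
theorem IsShort.relax (h : G.IsShort B S f) {x : Fin n} (hx : x ∈ B) :
    G.IsShort B (insert x S) (relax x f) := by
  intro u hu v hv ys w hw hn hS
  unfold _root_.relax
  by_cases hxy : x ∈ ys
  · obtain ⟨a, b, rfl⟩ := List.append_of_mem hxy
    obtain ⟨w₁, w₂, rfl, h₁, h₂⟩ := hw.split
    have hn' := (List.nodup_middle.1 hn)
    rw [List.nodup_cons, List.mem_append, List.nodup_append] at hn'
    obtain ⟨hx', ha, hb, -⟩ := hn'
    refine inf_le_right.trans ?_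
    push_cast
    refine add_le_add (h u hu x hx a w₁ h₁ ha fun y hy => ?_)
      (h x hx v hv b w₂ h₂ hb fun y hy => ?_)
    · exact (hS y (by simp [hy])).resolve_left fun e => hx' (.inl (e ▸ hy))
    · exact (hS y (by simp [hy])).resolve_left fun e => hx' (.inr (e ▸ hy))
  · refine inf_le_left.trans (h u hu v hv ys w hw hn fun y hy => ?_)
    exact (hS y hy).resolve_left fun e => hxy (e ▸ hy)

theorem CoversCycles.mono {c' : WithTop ℤ} (h : G.CoversCycles S c) (hc : c' ≤ c) :
    G.CoversCycles S c' :=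
  fun x ys w hw hn hS => hc.trans (h x ys w hw hn hS)

/-- A simple cycle through `x` can be rotated to start at `x`, and is then bounded by the diagonal
entry. A cycle that avoids `x` was covered before. -/
theorem CoversCycles.relax (hc : G.CoversCycles S c) (h : G.IsShort B S f) {x : Fin n}
    (hx : x ∈ B) : G.CoversCycles (insert x S) (c ⊓ relax x f x x) := by
  have key : ∀ ys w, G.HasWalk x ys x w → (x :: ys).Nodup → (∀ y ∈ x :: ys, y ∈ insert x S) →
      c ⊓ _root_.relax x f x x ≤ (w : ℤ) := by
    intro ys w hw hn hS
    exact inf_le_right.trans (h.relax hx x hx x hx ys w hw (List.nodup_cons.1 hn).2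
      fun y hy => hS y (by simp [hy]))
  intro z ys w hw hn hS
  by_cases hxz : x ∈ z :: ys
  · rcases List.mem_cons.1 hxz with rfl | hxy
    · exact key ys w hw hn hS
    · obtain ⟨a, b, rfl⟩ := List.append_of_mem hxy
      have hp : (x :: (b ++ z :: a)).Perm (z :: (a ++ x :: b)) := by
        have : (x :: b ++ z :: a).Perm ((z :: a) ++ (x :: b)) := List.perm_append_comm
        simpa using this
      exact key _ w hw.rotate (hp.nodup_iff.2 hn) fun y hy => hS y (hp.mem_iff.1 hy)
  · refine inf_le_left.trans (hc z ys w hw hn fun y hy => ?_)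
    exact (hS y hy).resolve_left fun e => hxz (e ▸ hy)

end WeightedDigraph

namespace TreeDecomposition

variable {n : ℕ} {G : WeightedDigraph n} {m : ℕ} {D : TreeDecomposition G m}

/-- A walk without interior nodes is an edge. Otherwise its first interior node lies below one child
`j`, the remaining interior nodes stay there because they avoid `bag i`, and both ends are forced
into `bag j`, so the map of `j` applies. -/
theorem isShort_of_children {i : Fin m} {f : Fin n → Fin n → WithTop ℤ}
    (hwt : ∀ u ∈ D.bag i, ∀ v ∈ D.bag i, G.Adj u v → f u v ≤ (G.wt u v : ℤ))
    (hch : ∀ j, D.IsChild i j → ∃ g, G.IsShort (D.bag j) (D.ownNodes j) g ∧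
      ∀ u ∈ D.bag i, ∀ v ∈ D.bag i, u ∈ D.bag j → v ∈ D.bag j → f u v ≤ g u v) :
    G.IsShort (D.bag i) (D.ownNodes i \ D.bag i) f := by
  intro u hu v hv ys w hw hn hS
  cases hw with
  | edge h => exact hwt u hu v hv h
  | @cons _ y _ ys w h hw =>
    obtain ⟨j, hij, hy⟩ := exists_child_mem_ownNodes (hS y (by simp)).1 (hS y (by simp)).2
    obtain ⟨g, hg, hfg⟩ := hch j hij
    obtain ⟨h1, h2⟩ := hasWalk_below_child hij hw hy fun z hz => (hS z (by simp [hz])).2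
    have huj := adj_mem_bag hij (.inr h) hy hu
    refine (hfg u hu v hv huj (h2 hv)).trans (hg u huj v (h2 hv) _ _ (.cons h hw) hn ?_)
    intro z hz
    rcases List.mem_cons.1 hz with rfl | hz
    · exact hy
    · exact h1 z hz

/-- A cycle that avoids `bag i` cannot leave the subtree of the child in which it starts. -/
theorem coversCycles_of_children {i : Fin m} {c : WithTop ℤ}
    (hch : ∀ j, D.IsChild i j → G.CoversCycles (D.ownNodes j) c) :
    G.CoversCycles (D.ownNodes i \ D.bag i) c := by
  intro x ys w hw hn hS
  obtain ⟨j, hij, hx⟩ := exists_child_mem_ownNodes (hS x (by simp)).1 (hS x (by simp)).2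
  refine hch j hij x ys w hw hn ?_
  intro z hz
  rcases List.mem_cons.1 hz with rfl | hz
  · exact hx
  · exact (hasWalk_below_child hij hw hx fun z hz => (hS z (by simp [hz])).2).1 z hz

end TreeDecomposition

/-! ## Words that hold natural numbers -/

namespace Word

/-- The word that holds a natural number. -/
def nat (k : ℕ) : Word := ((k : ℤ) : WithTop ℤ)

@[simp] theorem toNat_nat (k : ℕ) : (nat k).toNat = k := by
  rfl

@[simp] theorem nat_inj {a b : ℕ} : nat a = nat b ↔ a = b := by
  simp [nat]

@[simp] theorem nat_ne_top (a : ℕ) : nat a ≠ ⊤ := WithTop.coe_ne_top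

@[simp] theorem nat_add (a b : ℕ) : nat a + nat b = nat (a + b) := by
  simp only [nat]
  push_cast
  rfl

@[simp] theorem nat_mul (a b : ℕ) :
    WithTop.map₂ (fun a b : ℤ => a * b) (nat a) (nat b) = nat (a * b) := by
  simp only [nat, WithTop.map₂_coe_coe]
  push_cast
  rfl

theorem nat_sub {a b : ℕ} (h : b ≤ a) :
    WithTop.map₂ (fun a b : ℤ => a - b) (nat a) (nat b) = nat (a - b) := by
  simp only [nat, WithTop.map₂_coe_coe]
  push_cast [h]
  rfl

theorem ofFin_eq {k : ℕ} (i : Fin k) : ofFin i = nat i := rfl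

@[simp] theorem ofFin_inj {k : ℕ} {i j : Fin k} : ofFin i = ofFin j ↔ i = j := by
  rw [ofFin_eq, ofFin_eq, nat_inj, Fin.ext_iff]

@[simp] theorem ofFin_ne_top {k : ℕ} (i : Fin k) : ofFin i ≠ ⊤ := nat_ne_top _

@[simp] theorem ofOption_some {k : ℕ} (i : Fin k) : ofOption (some i) = ofFin i := rfl

@[simp] theorem ofOption_none {k : ℕ} : ofOption (none : Option (Fin k)) = ⊤ := rfl

@[simp] theorem ofOption_eq_ofFin {k : ℕ} {o : Option (Fin k)} {i : Fin k} :
    ofOption o = ofFin i ↔ o = some i := by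
  cases o with
  | none => simp [(ofFin_ne_top i).symm]
  | some j => simp

@[simp] theorem toFin?_ofOption {k : ℕ} (o : Option (Fin k)) : toFin? k (ofOption o) = o := by
  cases o with
  | none => simp [toFin?]
  | some i => simp [toFin?, ofFin_eq]

@[simp] theorem toFin?_ofFin {k : ℕ} (i : Fin k) : toFin? k (ofFin i) = some i :=
  toFin?_ofOption (some i)

end Word

open Word

/-! ## Answers to the queries -/

namespace TreeDecomposition.Listing

variable {n : ℕ} {G : WeightedDigraph n} {m : ℕ} {D : TreeDecomposition G m} (L : D.Listing)

/-- The nodes of a bag that may be null. -/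
def optNodes (o : Option (Fin m)) : List (Fin n) := o.elim [] L.nodes

@[simp] theorem bagSize_ofOption (o : Option (Fin m)) :
    L.toInput.bagSize (ofOption o) = nat (L.optNodes o).length := by
  simp only [toInput, toFin?_ofOption]
  cases o <;> rfl

@[simp] theorem bagSize_ofFin (i : Fin m) :
    L.toInput.bagSize (ofFin i) = nat (L.nodes i).length :=
  L.bagSize_ofOption (some i)

theorem bagNode_ofOption (o : Option (Fin m)) (k : ℕ) :
    L.toInput.bagNode (ofOption o) (nat k) = ofOption (L.optNodes o)[k]? := by
  simp only [toInput, toFin?_ofOption, toNat_nat]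
  cases o <;> rfl

theorem bagNode_ofOption_of_lt (o : Option (Fin m)) {k : ℕ} (h : k < (L.optNodes o).length) :
    L.toInput.bagNode (ofOption o) (nat k) = ofFin (L.optNodes o)[k] := by
  rw [bagNode_ofOption, List.getElem?_eq_getElem h, ofOption_some]

theorem bagNode_ofFin_of_lt (i : Fin m) {k : ℕ} (h : k < (L.nodes i).length) :
    L.toInput.bagNode (ofFin i) (nat k) = ofFin (L.nodes i)[k] :=
  L.bagNode_ofOption_of_lt (some i) h

@[simp] theorem parent_ofFin (i : Fin m) :
    L.toInput.parent (ofFin i) = ofOption (L.parent i) := by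
  simp [toInput]

@[simp] theorem child_ofFin (i : Fin m) (k : ℕ) :
    L.toInput.child (ofFin i) (nat k) = ofOption (L.children i)[k]? := by
  simp [toInput]

open Classical in
@[simp] theorem weight_ofFin (u v : Fin n) :
    L.toInput.weight (ofFin u) (ofFin v) = if G.Adj u v then (G.wt u v : WithTop ℤ) else ⊤ := by
  simp [toInput]

theorem length_nodes_le {t : ℕ} (h : D.WidthAtMost t) (i : Fin m) :
    (L.nodes i).length ≤ t + 1 := by
  classical
  rw [← List.toFinset_card_of_nodup (L.nodes_nodup i)]
  convert h i using 2
  ext u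
  simp [L.mem_nodes]

theorem exists_bagSize {t : ℕ} (h : D.WidthAtMost t) (w : Word) :
    ∃ k ≤ t + 1, L.toInput.bagSize w = nat k := by
  simp only [toInput]
  cases w.toFin? m with
  | none => exact ⟨0, by omega, rfl⟩
  | some j => exact ⟨_, L.length_nodes_le h j, rfl⟩

end TreeDecomposition.Listing

/-! ## Reasoning about programs -/

namespace Prog

variable {R : Type}

/-- The registers that a program may change. -/
def writes : Prog R → List R
  | skip | store _ _ => []
  | assign r _ => [r]
  | seq p q | ifEq _ _ p q => p.writes ++ q.writes
  | loop r _ p => r :: p.writes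

/-- The program does not write to the work memory. -/
def storeFree : Prog R → Prop
  | skip | assign _ _ => True
  | store _ _ => False
  | seq p q | ifEq _ _ p q => p.storeFree ∧ q.storeFree
  | loop _ _ p => p.storeFree

theorem foldl_induction {α β : Type*} (P : β → Prop) (g : β → α → β) (h : ∀ b a, P b → P (g b a))
    (l : List α) (b : β) (hb : P b) : P (l.foldl g b) := by
  induction l generalizing b with
  | nil => exact hb
  | cons a l ih => exact ih _ (h b a hb)

variable [DecidableEq R] {I : RamInput}

theorem exec_skip (s : RamState R) : (skip : Prog R).exec I s = s := rfl

theorem exec_seq (p q : Prog R) (s : RamState R) :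
    (seq p q).exec I s = q.exec I (p.exec I s) := rfl

theorem exec_assign_self (r : R) (e : Expr R) (s : RamState R) :
    ((assign r e).exec I s).regs r = e.eval I s :=
  Function.update_self _ _ _

theorem exec_ifEq_of_eq {x y : Expr R} {p q : Prog R} {s : RamState R}
    (h : x.eval I s = y.eval I s) :
    (ifEq x y p q).exec I s = p.exec I (s.tick (x.cost + y.cost + 1)) := by
  rw [exec, if_pos h]

theorem exec_ifEq_of_ne {x y : Expr R} {p q : Prog R} {s : RamState R}
    (h : x.eval I s ≠ y.eval I s) :
    (ifEq x y p q).exec I s = q.exec I (s.tick (x.cost + y.cost + 1)) := by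
  rw [exec, if_neg h]

theorem setReg_tick_regs_self (s : RamState R) (r : R) (w : Word) (k : ℕ) :
    ((s.setReg r w).tick k).regs r = w :=
  Function.update_self _ _ _

theorem setReg_tick_regs_of_ne {r x : R} (h : x ≠ r) (s : RamState R) (w : Word) (k : ℕ) :
    ((s.setReg r w).tick k).regs x = s.regs x :=
  Function.update_of_ne h _ _

/-- One iteration of a loop. -/
def iterate (I : RamInput) (r : R) (p : Prog R) (t : RamState R) (i : ℕ) : RamState R :=
  p.exec I ((t.setReg r (nat i)).tick 1)

theorem exec_loop_eq (r : R) (e : Expr R) (p : Prog R) (s : RamState R) :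
    (loop r e p).exec I s =
      (List.range (e.eval I s).toNat).foldl (iterate I r p) (s.tick (e.cost + 1)) := by
  rw [exec]
  -- In `exec` the loop variable is an integer, and the list of naturals is coerced through the list
  -- monad. This turns it back into a fold over naturals.
  simp only [List.bind_eq_flatMap, List.pure_def, ← List.map_eq_flatMap,
    List.foldl_map]
  rfl

/-- The frame rule for registers. As `writes` is computed from the text of the program, its side
condition can be settled by `decide` for concrete programs. -/
theorem exec_regs {p : Prog R} {x : R} (hx : x ∉ p.writes) (s : RamState R) :
    (p.exec I s).regs x = s.regs x := by
  induction p generalizing s with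
  | skip => rfl
  | assign r e =>
    have : x ≠ r := by simpa [writes] using hx
    simp [exec, RamState.tick, RamState.setReg, this]
  | store a e => rfl
  | seq p q ihp ihq =>
    simp only [writes, List.mem_append, not_or] at hx
    rw [exec, ihq hx.2, ihp hx.1]
  | ifEq e e' p q ihp ihq =>
    simp only [writes, List.mem_append, not_or] at hx
    rw [exec]
    split_ifs
    · rw [ihp hx.1]; rfl
    · rw [ihq hx.2]; rfl
  | loop r e p ih =>
    simp only [writes, List.mem_cons, not_or] at hx
    rw [exec_loop_eq]
    refine foldl_induction (fun t : RamState R => t.regs x = s.regs x) _ ?_ _ _ rfl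
    intro t i ht
    rw [iterate, ih hx.2, ← ht]
    simp [RamState.tick, RamState.setReg, hx.1]

theorem exec_storeFree {p : Prog R} (hp : p.storeFree) (s : RamState R) :
    (p.exec I s).memory = s.memory ∧ (p.exec I s).used = s.used := by
  induction p generalizing s with
  | skip => exact ⟨rfl, rfl⟩
  | assign r e => exact ⟨rfl, rfl⟩
  | store a e => exact hp.elim
  | seq p q ihp ihq =>
    obtain ⟨h1, h2⟩ := ihp hp.1 s
    rw [exec, (ihq hp.2 _).1, (ihq hp.2 _).2]
    exact ⟨h1, h2⟩
  | ifEq e e' p q ihp ihq =>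
    rw [exec]
    split_ifs
    · exact ihp hp.1 _
    · exact ihq hp.2 _
  | loop r e p ih =>
    rw [exec_loop_eq]
    refine foldl_induction (fun t : RamState R => t.memory = s.memory ∧ t.used = s.used) _ ?_ _ _
      ⟨rfl, rfl⟩
    intro t i ht
    obtain ⟨h1, h2⟩ := ih hp ((t.setReg r (nat i)).tick 1)
    exact ⟨h1.trans ht.1, h2.trans ht.2⟩

/-- The rule for loops: an invariant holds at the end if it holds at the beginning and is preserved
by every iteration. -/
theorem exec_loop {r : R} {e : Expr R} {p : Prog R} {s : RamState R} {N : ℕ}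
    (Inv : ℕ → RamState R → Prop) (hN : e.eval I s = nat N)
    (h0 : Inv 0 (s.tick (e.cost + 1)))
    (hstep : ∀ i < N, ∀ t, (∀ x, x ∉ r :: p.writes → t.regs x = s.regs x) → Inv i t →
      Inv (i + 1) (p.exec I ((t.setReg r (nat i)).tick 1))) :
    Inv N ((loop r e p).exec I s) := by
  rw [exec_loop_eq, hN, toNat_nat]
  suffices ∀ k ≤ N, (∀ x, x ∉ r :: p.writes →
      ((List.range k).foldl (iterate I r p) (s.tick (e.cost + 1))).regs x = s.regs x) ∧
      Inv k ((List.range k).foldl (iterate I r p) (s.tick (e.cost + 1))) from (this N le_rfl).2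
  intro k
  induction k with
  | zero => exact fun _ => ⟨fun _ _ => rfl, h0⟩
  | succ k ih =>
    intro hk
    obtain ⟨h1, h2⟩ := ih (by omega)
    rw [List.range_succ, List.foldl_append, List.foldl_cons, List.foldl_nil]
    refine ⟨fun x hx => ?_, hstep k (by omega) _ h1 h2⟩
    rw [← h1 x hx]
    simp only [List.mem_cons, not_or] at hx
    rw [iterate, exec_regs hx.2]
    simp [RamState.tick, RamState.setReg, hx.1]

end Prog

/-! ### Maps stored row by row: filling and moving them -/

/-- The list `l` indexes the rows and columns of a map `f` stored row by row at `base`. -/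
def StoresMap {n : ℕ} (l : List (Fin n)) (base : ℕ) (memory : ℕ → Word)
    (f : Fin n → Fin n → Word) : Prop :=
  ∀ x y (hx : x < l.length) (hy : y < l.length), memory (base + x * l.length + y) = f l[x] l[y]

theorem mul_add_lt_mul {x y k : ℕ} (hx : x < k) (hy : y < k) : x * k + y < k * k := by
  have : (x + 1) * k ≤ k * k := Nat.mul_le_mul_right k hx
  rw [add_mul] at this
  omega

theorem StoresMap.congr {n : ℕ} {l : List (Fin n)} {base base' : ℕ} {mem mem' : ℕ → Word}
    {f : Fin n → Fin n → Word} (h : StoresMap l base mem f)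
    (e : ∀ z < l.length * l.length, mem' (base' + z) = mem (base + z)) :
    StoresMap l base' mem' f := by
  intro x y hx hy
  rw [add_assoc, e _ (mul_add_lt_mul hx hy), ← add_assoc, h x y hx hy]

namespace MinCycle

open Reg

variable {I : RamInput}

@[simp] theorem eval_entry {s : RamState Reg} {base d x y : Reg} {b k i j : ℕ}
    (hb : s.regs base = nat b) (hd : s.regs d = nat k) (hx : s.regs x = nat i)
    (hy : s.regs y = nat j) : (entry base d x y).eval I s = nat (b + i * k + j) := by
  change s.regs base + WithTop.map₂ (fun a b : ℤ => a * b) (s.regs x) (s.regs d) + s.regs y = _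
  simp [hb, hd, hx, hy]

/-- Two nested loops that fill a square map at address `a`. -/
theorem exec_fill {i' j' k' : Reg} {body : Prog Reg} {s : RamState Reg} {a N : ℕ}
    (F : ∀ x y, x < N → y < N → Word) (hk : s.regs k' = nat N) (hij : i' ∉ j' :: body.writes)
    (hk' : k' ∉ i' :: j' :: body.writes)
    (hbody : ∀ x y (hx : x < N) (hy : y < N) (t : RamState Reg),
      (∀ x, x ∉ i' :: j' :: body.writes → t.regs x = s.regs x) →
      t.regs i' = nat x → t.regs j' = nat y → (∀ z < a, t.memory z = s.memory z) →
      (body.exec I t).memory = Function.update t.memory (a + x * N + y) (F x y hx hy) ∧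
      (body.exec I t).used = max t.used (a + x * N + y + 1)) :
    let s' := (Prog.loop i' k' (.loop j' k' body)).exec I s
    (∀ z < a, s'.memory z = s.memory z) ∧ s'.used ≤ max s.used (a + N * N) ∧
      ∀ x y (hx : x < N) (hy : y < N), s'.memory (a + x * N + y) = F x y hx hy := by
  intro s'
  -- The cells before `(i, j)` in row-major order are filled. Thus `(i, N)` and `(i + 1, 0)`
  -- describe the same progress, which links the inner loop to the outer one.
  let Inv : ℕ → ℕ → RamState Reg → Prop := fun i j t =>
    (∀ z < a, t.memory z = s.memory z) ∧ t.used ≤ max s.used (a + N * N) ∧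
    (∀ x y (hx : x < N) (hy : y < N), x * N + y < i * N + j →
      t.memory (a + x * N + y) = F x y hx hy)
  have main : Inv N 0 s' := by
    refine Prog.exec_loop (fun i => Inv i 0) hk ⟨fun _ _ => rfl, le_max_left _ _, ?_⟩ ?_
    · intro x y hx hy h
      omega
    intro i hi t ht hinv
    suffices Inv i N ((Prog.loop j' k' body).exec I ((t.setReg i' (nat i)).tick 1)) by
      refine ⟨this.1, this.2.1, fun x y hx hy h => this.2.2 x y hx hy ?_⟩
      rw [add_mul] at h
      omega
    have hki : k' ≠ i' := by
      intro e
      simp [e] at hk'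
    have hk1 : ((t.setReg i' (nat i)).tick 1).regs k' = nat N := by
      rw [← hk, ← ht k' hk']
      simp [RamState.tick, RamState.setReg, hki]
    refine Prog.exec_loop (fun j => Inv i j) hk1 hinv ?_
    intro j hj' t' ht' hinv'
    have hregs : ∀ x, x ∉ i' :: j' :: body.writes →
        ((t'.setReg j' (nat j)).tick 1).regs x = s.regs x := by
      intro x hr
      rw [← ht x hr]
      simp only [List.mem_cons, not_or] at hr
      have := ht' x (by simp [hr])
      simp only [RamState.tick, RamState.setReg, Function.update_of_ne hr.1] at this
      simp [RamState.tick, RamState.setReg, hr.2.1, this]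
    have hi2 : ((t'.setReg j' (nat j)).tick 1).regs i' = nat i := by
      have := ht' i' hij
      simp only [RamState.tick, RamState.setReg, Function.update_self] at this
      simp only [List.mem_cons, not_or] at hij
      simp [RamState.tick, RamState.setReg, hij.1, this]
    have hj2 : ((t'.setReg j' (nat j)).tick 1).regs j' = nat j := by
      simp [RamState.tick, RamState.setReg]
    obtain ⟨h1, h2⟩ := hbody i j hi hj' _ hregs hi2 hj2 hinv'.1
    have hlt := mul_add_lt_mul hi hj'
    refine ⟨fun z hz => ?_, ?_, fun x y hx hy h => ?_⟩
    · rw [h1, Function.update_of_ne (by omega)]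
      exact hinv'.1 z hz
    · rw [h2]
      refine max_le hinv'.2.1 (le_max_of_le_right ?_)
      omega
    · rw [h1]
      by_cases e : x * N + y = i * N + j
      -- Equal addresses belong to equal cells: division by `N` recovers the row.
      · have hxi : x = i := by
          have h1 : (x * N + y) / N = x := by
            rw [mul_comm, Nat.mul_add_div (by omega), Nat.div_eq_of_lt hy, add_zero]
          have h2 : (i * N + j) / N = i := by
            rw [mul_comm, Nat.mul_add_div (by omega), Nat.div_eq_of_lt hj', add_zero]
          rw [← h1, e, h2]
        subst hxi
        obtain rfl : y = j := by omega
        simp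
      · rw [Function.update_of_ne (by omega)]
        exact hinv'.2.2 x y hx hy (by omega)
  refine ⟨main.1, main.2.1, fun x y hx hy => main.2.2 x y hx hy ?_⟩
  have := mul_add_lt_mul hx hy
  omega

/-- The rule for `moveDown`. The two areas may overlap. -/
theorem exec_moveDown {s : RamState Reg} {N a b : ℕ} (hk : s.regs k = nat N)
    (hb : s.regs base1 = nat b) (ha : s.regs sp = nat a) (hba : b ≤ a) :
    let s' := moveDown.exec I s
    (∀ z < b, s'.memory z = s.memory z) ∧ s'.used ≤ max s.used (b + N * N) ∧
      ∀ z < N * N, s'.memory (b + z) = s.memory (a + z) := by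
  intro s'
  -- The extra last clause handles overlap. Copying runs upwards and `b ≤ a`, so the source cell `a
  -- + i` lies in the part from `b + i` on, which is not yet overwritten.
  suffices (∀ z < b, s'.memory z = s.memory z) ∧ s'.used ≤ max s.used (b + N * N) ∧
      (∀ z < N * N, s'.memory (b + z) = s.memory (a + z)) ∧
      ∀ z, b + N * N ≤ z → s'.memory z = s.memory z from ⟨this.1, this.2.1, this.2.2.1⟩
  refine Prog.exec_loop (N := N * N) (fun i t => (∀ z < b, t.memory z = s.memory z) ∧
    t.used ≤ max s.used (b + N * N) ∧
    (∀ z < i, t.memory (b + z) = s.memory (a + z)) ∧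
    ∀ z, b + i ≤ z → t.memory z = s.memory z) ?_ ?_ ?_
  · change WithTop.map₂ (fun a b : ℤ => a * b) (s.regs k) (s.regs k) = _
    rw [hk, nat_mul]
  · exact ⟨fun _ _ => rfl, le_max_left _ _, by simp, fun _ _ => rfl⟩
  · rintro i hi t ht ⟨h1, h2, h3, h4⟩
    have hb' : t.regs base1 = nat b := (ht _ (by decide)).trans hb
    have ha' : t.regs sp = nat a := (ht _ (by decide)).trans ha
    have e : Prog.exec I (.store ((base1 : Expr Reg) + (Reg.i : Expr Reg))
        (.mem ((sp : Expr Reg) + (Reg.i : Expr Reg)))) ((t.setReg Reg.i (nat i)).tick 1)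
        = (((t.setReg Reg.i (nat i)).tick 1).write (b + i) (t.memory (a + i))).tick 8 := by
      change RamState.tick (RamState.write _ (Word.toNat (Function.update t.regs Reg.i (nat i) base1
        + Function.update t.regs Reg.i (nat i) Reg.i)) (t.memory (Word.toNat
          (Function.update t.regs Reg.i (nat i) sp
        + Function.update t.regs Reg.i (nat i) Reg.i)))) 8 = _
      simp [ha', hb']
    rw [e]
    refine ⟨fun z hz => ?_, ?_, fun z hz => ?_, fun z hz => ?_⟩
    · change Function.update t.memory (b + i) _ z = _
      rw [Function.update_of_ne (by omega), h1 z hz]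
    · change max t.used (b + i + 1) ≤ _
      exact max_le h2 (le_max_of_le_right (by omega))
    · change Function.update t.memory (b + i) _ (b + z) = _
      by_cases hzi : z = i
      · subst hzi
        rw [Function.update_self, h4 _ (by omega)]
      · rw [Function.update_of_ne (by omega), h3 z (by omega)]
    · change Function.update t.memory (b + i) _ z = _
      rw [Function.update_of_ne (by omega), h4 z (by omega)]

end MinCycle

namespace MinCycle

open Reg

/-! ## Running time -/

/-- The registers that hold sizes of bags hold numbers up to `K`. -/
def SizesBounded (K : ℕ) (s : RamState Reg) : Prop :=
  ∀ x ∈ [k, k1, k2], ∃ a ≤ K, s.regs x = nat a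

/-- The loop bound `e` is a size of a bag or a square of such a size. -/
def IsSizeExpr (e : Expr Reg) : Prop :=
  (∃ x ∈ [k, k1, k2], e = .reg x) ∨ e = (k : Expr Reg) * (k : Expr Reg) ∨ ∃ b, e = .bagSize b

/-- Registers for sizes hold sizes only, and the bounds of all loops are sizes or squares of
sizes. -/
def LoopsBySizes : Prog Reg → Prop
  | .skip | .store _ _ => True
  | .assign x e => x ∉ [k, k1, k2] ∨ ∃ b, e = .bagSize b
  | .seq P Q | .ifEq _ _ P Q => LoopsBySizes P ∧ LoopsBySizes Q
  | .loop x e P => x ∉ [k, k1, k2] ∧ IsSizeExpr e ∧ LoopsBySizes P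

/-- A bound for the running time of a program if bags have at most `K` nodes. -/
def timeBound (K : ℕ) : Prog Reg → ℕ
  | .skip => 0
  | .assign _ e => e.cost + 1
  | .store a e => a.cost + e.cost + 1
  | .seq P Q => timeBound K P + timeBound K Q
  | .ifEq x y P Q => x.cost + y.cost + 1 + (timeBound K P + timeBound K Q)
  | .loop _ e P => e.cost + 1 + (K + K * K) * (1 + timeBound K P)

theorem IsSizeExpr.toNat_eval_le {K : ℕ} {I : RamInput} (hI : ∀ w, ∃ a ≤ K, I.bagSize w = nat a)
    {s : RamState Reg} (hs : SizesBounded K s) {e : Expr Reg} (he : IsSizeExpr e) :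
    (e.eval I s).toNat ≤ K + K * K := by
  rcases he with ⟨x, hx, rfl⟩ | rfl | ⟨b, rfl⟩
  · obtain ⟨a, ha, e⟩ := hs x hx
    change (s.regs x).toNat ≤ _
    rw [e, toNat_nat]
    omega
  · obtain ⟨a, ha, e⟩ := hs k (by simp)
    change Word.toNat (WithTop.map₂ (fun a b : ℤ => a * b) (s.regs k) (s.regs k)) ≤ _
    rw [e, nat_mul, toNat_nat]
    have := Nat.mul_le_mul ha ha
    omega
  · obtain ⟨a, ha, e⟩ := hI (b.eval I s)
    change (I.bagSize (b.eval I s)).toNat ≤ _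
    rw [e, toNat_nat]
    omega

theorem SizesBounded.setReg {K : ℕ} {s : RamState Reg} (hs : SizesBounded K s) {x : Reg}
    (hx : x ∉ [k, k1, k2]) (w : Word) (l : ℕ) : SizesBounded K ((s.setReg x w).tick l) := by
  intro y hy
  obtain ⟨a, ha, e⟩ := hs y hy
  refine ⟨a, ha, ?_⟩
  rw [← e]
  exact Function.update_of_ne (by rintro rfl; exact hx hy) _ _

/-- Every loop bound is a size or the square of a size, hence at most `K + K * K`, independently of
what memory holds. The bound on the size registers must be carried along, because later loops read
them. -/
theorem exec_time_le {K : ℕ} {I : RamInput} (hI : ∀ w, ∃ a ≤ K, I.bagSize w = nat a)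
    {p : Prog Reg} (hp : LoopsBySizes p) {s : RamState Reg} (hs : SizesBounded K s) :
    SizesBounded K (p.exec I s) ∧ (p.exec I s).time ≤ s.time + timeBound K p := by
  induction p generalizing s with
  | skip => exact ⟨hs, le_rfl⟩
  | store a e => exact ⟨hs, le_rfl⟩
  | assign x e =>
    refine ⟨?_, le_rfl⟩
    rcases hp with hx | ⟨b, rfl⟩
    · exact hs.setReg hx _ _
    · intro y hy
      by_cases hxy : y = x
      · subst hxy
        obtain ⟨a, ha, e⟩ := hI (b.eval I s)
        exact ⟨a, ha, (Function.update_self _ _ _).trans e⟩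
      · obtain ⟨a, ha, e⟩ := hs y hy
        exact ⟨a, ha, (Function.update_of_ne hxy _ _).trans e⟩
  | seq p q ihp ihq =>
    obtain ⟨h1, h2⟩ := ihp hp.1 hs
    obtain ⟨h3, h4⟩ := ihq hp.2 h1
    refine ⟨h3, ?_⟩
    rw [Prog.exec, timeBound]
    omega
  | ifEq x y p q ihp ihq =>
    have hs' : SizesBounded K (s.tick (x.cost + y.cost + 1)) := hs
    rw [Prog.exec, timeBound]
    split_ifs
    · obtain ⟨h1, h2⟩ := ihp hp.1 hs'
      refine ⟨h1, h2.trans ?_⟩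
      simp only [RamState.tick]
      omega
    · obtain ⟨h1, h2⟩ := ihq hp.2 hs'
      refine ⟨h1, h2.trans ?_⟩
      simp only [RamState.tick]
      omega
  | loop x e p ih =>
    obtain ⟨hx, he, hp⟩ := hp
    have hN := he.toNat_eval_le hI hs
    rw [Prog.exec_loop_eq, timeBound]
    have key : ∀ N, SizesBounded K
          ((List.range N).foldl (Prog.iterate I x p) (s.tick (e.cost + 1))) ∧
        ((List.range N).foldl (Prog.iterate I x p) (s.tick (e.cost + 1))).time ≤
          s.time + (e.cost + 1 + N * (1 + timeBound K p)) := by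
      intro N
      induction N with
      | zero => exact ⟨hs, by simp [RamState.tick]⟩
      | succ N ihN =>
        rw [List.range_succ, List.foldl_append, List.foldl_cons, List.foldl_nil]
        obtain ⟨h1, h2⟩ := ih hp (ihN.1.setReg hx (nat N) 1)
        refine ⟨h1, h2.trans ?_⟩
        have := ihN.2
        rw [add_mul, one_mul, RamState.tick, RamState.setReg]
        dsimp only
        omega
    refine ⟨(key _).1, (key _).2.trans ?_⟩
    have := Nat.mul_le_mul_right (1 + timeBound K p) hN
    omega

theorem loopsBySizes_move : LoopsBySizes move := by
  simp [LoopsBySizes, IsSizeExpr, move, Prog.block, examine, combine, minWithChild, moveDown,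
    testRoot, shorten]

end MinCycle

namespace MinCycle

open Reg

/-! ## The parts of the program -/

variable {n : ℕ} {G : WeightedDigraph n} {m : ℕ} {D : TreeDecomposition G m} {L : D.Listing}

/-- The map `f` on the nodes of `l`, extended by `∞`. -/
def restrict (l : List (Fin n)) (f : Fin n → Fin n → Word) (u v : Fin n) : Word :=
  if u ∈ l ∧ v ∈ l then f u v else ⊤

theorem inf_ite_top (P Q R : Prop) [Decidable P] [Decidable Q] [Decidable R] (z : Word) :
    (if P ∧ R then z else ⊤) ⊓ (if Q ∧ R then z else ⊤) = if (P ∨ Q) ∧ R then z else ⊤ := by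
  by_cases P <;> by_cases Q <;> by_cases R <;> simp_all

/-- The double loop searches the child's bag for the pair of nodes; a missing node, or a null child,
leaves `val` alone, which is a minimum with `∞`. The register arguments are arbitrary up to clashes
so that both children are served. -/
theorem exec_minWithChild {child d base : Reg} (hc : child ∉ [p, q, val]) (hd : d ∉ [p, q, val])
    (hb : base ∉ [p, q, val]) {s : RamState Reg} {o : Option (Fin m)} {B : Fin m} {x y b : ℕ}
    (hx : x < (L.nodes B).length) (hy : y < (L.nodes B).length) {f : Fin n → Fin n → Word}
    (hcur : s.regs cur = ofFin B) (hi : s.regs i = nat x) (hj : s.regs j = nat y)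
    (hchild : s.regs child = ofOption o) (hdim : s.regs d = nat (L.optNodes o).length)
    (hbase : s.regs base = nat b) (hf : StoresMap (L.optNodes o) b s.memory f) :
    ((minWithChild child d base).exec L.toInput s).regs val =
      s.regs val ⊓ restrict (L.optNodes o) f (L.nodes B)[x] (L.nodes B)[y] := by
  set l := L.optNodes o with hl
  set u := (L.nodes B)[x] with hu
  set v := (L.nodes B)[y] with hv
  have key : (((minWithChild child d base).exec L.toInput s).regs val =
      s.regs val ⊓ (if u ∈ l.take l.length ∧ v ∈ l then f u v else ⊤) ∧
      ((minWithChild child d base).exec L.toInput s).memory = s.memory) := by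
    -- After `a` rows only the first `a` nodes of the child have been compared with `u`. The inner
    -- loop refines the same condition by a prefix of the columns, and `inf_ite_top` merges a
    -- completed row.
    refine Prog.exec_loop (fun a t => t.regs val =
      s.regs val ⊓ (if u ∈ l.take a ∧ v ∈ l then f u v else ⊤) ∧ t.memory = s.memory) hdim ?_ ?_
    · exact ⟨by simp [RamState.tick], rfl⟩
    intro a ha t ht hval
    set t₁ := (t.setReg p (nat a)).tick 1 with ht₁
    have hp₁ : t₁.regs p = nat a := Prog.setReg_tick_regs_self _ _ _ _
    have hr₁ : ∀ z, z ∉ [p, q, val] → t₁.regs z = s.regs z := by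
      intro z hz
      rw [← ht z (by simpa [Prog.writes] using hz)]
      exact Function.update_of_ne (by rintro rfl; simp at hz) _ _
    have hval₁ : t₁.regs val = t.regs val :=
      Prog.setReg_tick_regs_of_ne (by decide) _ _ _
    have hmem₁ : t₁.memory = s.memory := hval.2
    rw [← hval₁] at hval
    have hinner := Prog.exec_loop (I := L.toInput) (r := q) (e := .reg d) (s := t₁)
      (p := .ifEq (.bagNode child p) (.bagNode cur i)
        (.ifEq (.bagNode child q) (.bagNode cur j)
          (.assign val (.min val (.mem (entry base d p q)))) .skip) .skip)
      (fun b t' => t'.regs val =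
        t₁.regs val ⊓ (if u = l[a] ∧ v ∈ l.take b then f u v else ⊤) ∧ t'.memory = s.memory)
      ((hr₁ d hd).trans hdim) ⟨by simp [RamState.tick], hmem₁⟩ ?_
    · refine ⟨?_, hinner.2⟩
      rw [List.take_length] at hinner
      refine hinner.1.trans ?_
      rw [hval.1, inf_assoc]
      congr 1
      rw [List.take_add_one, List.getElem?_eq_getElem ha]
      simp only [List.mem_append, Option.toList_some, List.mem_singleton]
      exact inf_ite_top _ _ _ _
    · intro c hc' t' ht' hval'
      set t₂ := (t'.setReg q (nat c)).tick 1 with ht₂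
      have hq₂ : t₂.regs q = nat c := Prog.setReg_tick_regs_self _ _ _ _
      have hr₂ : ∀ z, z ∉ [q, val] → t₂.regs z = t₁.regs z := by
        intro z hz
        rw [← ht' z (by simpa [Prog.writes] using hz)]
        exact Function.update_of_ne (by rintro rfl; simp at hz) _ _
      have hp₂ : t₂.regs p = nat a := (hr₂ p (by decide)).trans hp₁
      have hr₃ : ∀ z, z ∉ [p, q, val] → t₂.regs z = s.regs z := by
        intro z hz
        rw [hr₂ z (by simp at hz ⊢; tauto), hr₁ z hz]
      have hval₂ : t₂.regs val = t'.regs val :=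
      Prog.setReg_tick_regs_of_ne (by decide) _ _ _
      have hmem₂ : t₂.memory = s.memory := hval'.2
      refine ⟨?_, (Prog.exec_storeFree (by simp [Prog.storeFree]) _).1.trans hmem₂⟩
      rw [← hval₂] at hval'
      have e1 : Expr.eval L.toInput t₂ (.bagNode child p) = ofFin l[a] := by
        change L.toInput.bagNode (t₂.regs child) (t₂.regs p) = _
        rw [hr₃ child hc, hchild, hp₂, L.bagNode_ofOption_of_lt o ha]
      have e2 : Expr.eval L.toInput t₂ (.bagNode child q) = ofFin l[c] := by
        change L.toInput.bagNode (t₂.regs child) (t₂.regs q) = _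
        rw [hr₃ child hc, hchild, hq₂, L.bagNode_ofOption_of_lt o hc']
      have e3 : Expr.eval L.toInput t₂ (.bagNode cur i) = ofFin u := by
        change L.toInput.bagNode (t₂.regs cur) (t₂.regs i) = _
        rw [hr₃ cur (by decide), hr₃ i (by decide), hcur, hi, L.bagNode_ofFin_of_lt B hx]
      have e4 : ∀ z, Expr.eval L.toInput (t₂.tick z) (.bagNode cur j) = ofFin v := by
        intro z
        change L.toInput.bagNode (t₂.regs cur) (t₂.regs j) = _
        rw [hr₃ cur (by decide), hr₃ j (by decide), hcur, hj, L.bagNode_ofFin_of_lt B hy]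
      have e5 : (Expr.mem (entry base d p q)).eval L.toInput t₂ = f l[a] l[c] := by
        change t₂.memory (Word.toNat ((entry base d p q).eval L.toInput t₂)) = _
        rw [eval_entry ((hr₃ base hb).trans hbase) ((hr₃ d hd).trans hdim) hp₂ hq₂, toNat_nat,
          hmem₂, hf a c ha hc']
      have e2' : ∀ z, Expr.eval L.toInput (t₂.tick z) (.bagNode child q) = ofFin l[c] :=
        fun _ => e2
      have e5' : ∀ z z', Expr.eval L.toInput ((t₂.tick z).tick z')
          (.min val (.mem (entry base d p q))) = t₂.regs val ⊓ f l[a] l[c] := by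
        intro z z'
        rw [← e5]
        rfl
      rw [List.take_add_one, List.getElem?_eq_getElem hc']
      simp only [List.mem_append, Option.toList_some, List.mem_singleton]
      by_cases h1 : l[a] = u
      · rw [Prog.exec_ifEq_of_eq (by rw [e1, e3, h1])]
        by_cases h2 : l[c] = v
        · rw [Prog.exec_ifEq_of_eq (by rw [e2', e4, h2]), Prog.exec_assign_self, e5', hval'.1, h1,
            h2]
          by_cases h3 : v ∈ l.take c <;> simp [h3]
        · rw [Prog.exec_ifEq_of_ne (by rw [e2', e4, ne_eq, ofFin_inj]; exact h2)]
          refine hval'.1.trans ?_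
          have h2' : ¬ v = l[c] := fun h => h2 h.symm
          simp [h2']
      · rw [Prog.exec_ifEq_of_ne (by rw [e1, e3, ne_eq, ofFin_inj]; exact h1)]
        refine hval'.1.trans ?_
        have h1' : ¬ u = l[a] := fun h => h1 h.symm
        simp [h1']
  rw [key.1, restrict, List.take_length]

/-- The map computed by `combine`. -/
noncomputable def combinedMap (G : WeightedDigraph n) (l₁ l₂ : List (Fin n))
    (f₁ f₂ : Fin n → Fin n → Word) (u v : Fin n) : Word :=
  open Classical in
  (if G.Adj u v then (G.wt u v : WithTop ℤ) else ⊤) ⊓ restrict l₁ f₁ u v ⊓ restrict l₂ f₂ u v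

/-- Both children's maps end at or below `a`, where the new map begins, so they stay readable
throughout. -/
theorem exec_combine {s : RamState Reg} {B : Fin m} {o₁ o₂ : Option (Fin m)} {a b₁ b₂ : ℕ}
    {f₁ f₂ : Fin n → Fin n → Word}
    (hcur : s.regs cur = ofFin B) (hk : s.regs k = nat (L.nodes B).length)
    (hch1 : s.regs ch1 = ofOption o₁) (hk1 : s.regs k1 = nat (L.optNodes o₁).length)
    (hbase1 : s.regs base1 = nat b₁) (hf₁ : StoresMap (L.optNodes o₁) b₁ s.memory f₁)
    (hb₁ : b₁ + (L.optNodes o₁).length * (L.optNodes o₁).length ≤ a)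
    (hch2 : s.regs ch2 = ofOption o₂) (hk2 : s.regs k2 = nat (L.optNodes o₂).length)
    (hbase2 : s.regs base2 = nat b₂) (hf₂ : StoresMap (L.optNodes o₂) b₂ s.memory f₂)
    (hb₂ : b₂ + (L.optNodes o₂).length * (L.optNodes o₂).length ≤ a)
    (hsp : s.regs sp = nat a) :
    let s' := combine.exec L.toInput s
    (∀ z < a, s'.memory z = s.memory z) ∧
    s'.used ≤ max s.used (a + (L.nodes B).length * (L.nodes B).length) ∧
    StoresMap (L.nodes B) a s'.memory
      (combinedMap G (L.optNodes o₁) (L.optNodes o₂) f₁ f₂) := by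
  refine exec_fill (fun x y hx hy => combinedMap G (L.optNodes o₁) (L.optNodes o₂) f₁ f₂
    (L.nodes B)[x] (L.nodes B)[y]) hk (by decide) (by decide) ?_
  intro x y hx hy t hr hi hj hmem
  replace hr : ∀ z, z ∉ [i, j, val, p, q] → t.regs z = s.regs z := fun z hz =>
    hr z (by simp [Prog.writes, Prog.block, minWithChild] at hz ⊢; tauto)
  simp only [Prog.block, Prog.exec_seq]
  set t₁ := Prog.exec L.toInput (.assign val (.weight (.bagNode cur i) (.bagNode cur j))) t
    with ht₁
  set t₂ := (minWithChild ch1 k1 base1).exec L.toInput t₁ with ht₂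
  set t₃ := (minWithChild ch2 k2 base2).exec L.toInput t₂ with ht₃
  have hm₂ := Prog.exec_storeFree (I := L.toInput) (p := minWithChild ch1 k1 base1)
    (by simp [minWithChild, Prog.storeFree]) t₁
  have hm₃ := Prog.exec_storeFree (I := L.toInput) (p := minWithChild ch2 k2 base2)
    (by simp [minWithChild, Prog.storeFree]) t₂
  rw [← ht₂] at hm₂
  rw [← ht₃] at hm₃
  have hr₁ : ∀ z, z ∉ [val] → t₁.regs z = t.regs z := fun z hz => Prog.exec_regs hz t
  have hr₂ : ∀ z, z ∉ [val, p, q] → t₂.regs z = t.regs z := by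
    intro z hz
    rw [ht₂, Prog.exec_regs (by simp [Prog.writes, minWithChild] at hz ⊢; tauto),
      hr₁ z (by simp at hz ⊢; tauto)]
  have hr₃ : ∀ z, z ∉ [val, p, q] → t₃.regs z = t.regs z := by
    intro z hz
    rw [ht₃, Prog.exec_regs (by simp [Prog.writes, minWithChild] at hz ⊢; tauto), hr₂ z hz]
  have hv₁ : t₁.regs val = L.toInput.weight (ofFin (L.nodes B)[x]) (ofFin (L.nodes B)[y]) := by
    change Function.update t.regs val (L.toInput.weight (L.toInput.bagNode (t.regs cur) (t.regs i))
      (L.toInput.bagNode (t.regs cur) (t.regs j))) val = _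
    rw [Function.update_self, hi, hj, hr cur (by decide), hcur, L.bagNode_ofFin_of_lt B hx,
      L.bagNode_ofFin_of_lt B hy]
  have hf₁' : StoresMap (L.optNodes o₁) b₁ t₁.memory f₁ :=
    hf₁.congr fun z hz => hmem _ (by omega)
  have hf₂' : StoresMap (L.optNodes o₂) b₂ t₂.memory f₂ :=
    hf₂.congr fun z hz => by
      rw [hm₂.1]
      exact hmem _ (by omega)
  have hv₂ := exec_minWithChild (L := L) (child := ch1) (d := k1) (base := base1) (s := t₁)
    (by decide) (by decide) (by decide) hx hy
    (by rw [hr₁ _ (by decide), hr _ (by decide), hcur])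
    (by rw [hr₁ _ (by decide), hi]) (by rw [hr₁ _ (by decide), hj])
    (by rw [hr₁ _ (by decide), hr _ (by decide), hch1])
    (by rw [hr₁ _ (by decide), hr _ (by decide), hk1])
    (by rw [hr₁ _ (by decide), hr _ (by decide), hbase1]) hf₁'
  have hv₃ := exec_minWithChild (L := L) (child := ch2) (d := k2) (base := base2) (s := t₂)
    (by decide) (by decide) (by decide) hx hy
    (by rw [hr₂ _ (by decide), hr _ (by decide), hcur])
    (by rw [hr₂ _ (by decide), hi]) (by rw [hr₂ _ (by decide), hj])
    (by rw [hr₂ _ (by decide), hr _ (by decide), hch2])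
    (by rw [hr₂ _ (by decide), hr _ (by decide), hk2])
    (by rw [hr₂ _ (by decide), hr _ (by decide), hbase2]) hf₂'
  rw [← ht₂, hv₁, L.weight_ofFin] at hv₂
  rw [← ht₃, hv₂] at hv₃
  have haddr := eval_entry (I := L.toInput) (s := t₃) (base := sp) (d := k) (x := i) (y := j)
    ((hr₃ _ (by decide)).trans ((hr _ (by decide)).trans hsp))
    ((hr₃ _ (by decide)).trans ((hr _ (by decide)).trans hk))
    ((hr₃ _ (by decide)).trans hi) ((hr₃ _ (by decide)).trans hj)
  have hmem₃ : t₃.memory = t.memory := hm₃.1.trans hm₂.1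
  have hused₃ : t₃.used = t.used := hm₃.2.trans hm₂.2
  rw [Prog.exec, Prog.exec, haddr, toNat_nat]
  refine ⟨?_, ?_⟩
  · change Function.update t₃.memory _ (t₃.regs val) = _
    rw [hmem₃, hv₃]
    rfl
  · change max t₃.used _ = _
    rw [hused₃]

/-- At the root of the tree the parent is null and has size zero, so the loop is empty and every
node passes the test. -/
theorem exec_testRoot {s : RamState Reg} {B : Fin m} {x : ℕ} (hx : x < (L.nodes B).length)
    (hcur : s.regs cur = ofFin B) (hr : s.regs r = nat x) :
    (testRoot.exec L.toInput s).regs isRoot =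
      if (L.nodes B)[x] ∈ L.optNodes (L.parent B) then nat 0 else nat 1 := by
  set l := L.optNodes (L.parent B) with hl
  set u := (L.nodes B)[x] with hu
  simp only [testRoot, Prog.block, Prog.exec_seq]
  rw [Prog.exec]
  set s₁ := Prog.exec L.toInput (.assign isRoot (lit 1)) s with hs₁
  have hr₁ : ∀ z, z ∉ [isRoot] → s₁.regs z = s.regs z := fun z hz => Prog.exec_regs hz s
  have hN : Expr.eval L.toInput s₁ (.bagSize (.parent cur)) = nat l.length := by
    change L.toInput.bagSize (L.toInput.parent (s₁.regs cur)) = _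
    rw [hr₁ _ (by decide), hcur, L.parent_ofFin, L.bagSize_ofOption]
  have key := Prog.exec_loop (I := L.toInput) (r := p)
    (p := .ifEq (.bagNode (.parent cur) p) (.bagNode cur r) (.assign isRoot (lit 0)) .skip)
    (fun a t => t.regs isRoot = if u ∈ l.take a then nat 0 else nat 1) hN ?_ ?_
  · rw [List.take_length] at key
    exact key
  · rw [List.take_zero, if_neg (by simp)]
    exact Prog.exec_assign_self (I := L.toInput) isRoot (lit 1) s
  · intro a ha t ht hval
    set t₁ := (t.setReg p (nat a)).tick 1 with ht₁
    have hp₁ : t₁.regs p = nat a := Prog.setReg_tick_regs_self _ _ _ _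
    have hval₁ : t₁.regs isRoot = t.regs isRoot :=
      Prog.setReg_tick_regs_of_ne (by decide) _ _ _
    have hcur₁ : t₁.regs cur = ofFin B := by
      rw [← hcur, ← hr₁ cur (by decide), ← ht cur (by decide)]
      exact Prog.setReg_tick_regs_of_ne (by decide) _ _ _
    have hrr₁ : t₁.regs r = nat x := by
      rw [← hr, ← hr₁ r (by decide), ← ht r (by decide)]
      exact Prog.setReg_tick_regs_of_ne (by decide) _ _ _
    have e1 : Expr.eval L.toInput t₁ (.bagNode (.parent cur) p) = ofFin l[a] := by
      change L.toInput.bagNode (L.toInput.parent (t₁.regs cur)) (t₁.regs p) = _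
      rw [hcur₁, hp₁, L.parent_ofFin, L.bagNode_ofOption_of_lt _ ha]
    have e2 : Expr.eval L.toInput t₁ (.bagNode cur r) = ofFin u := by
      change L.toInput.bagNode (t₁.regs cur) (t₁.regs r) = _
      rw [hcur₁, hrr₁, L.bagNode_ofFin_of_lt B hx]
    rw [List.take_add_one, List.getElem?_eq_getElem ha]
    simp only [List.mem_append, Option.toList_some, List.mem_singleton]
    by_cases h1 : l[a] = u
    · rw [Prog.exec_ifEq_of_eq (by rw [e1, e2, h1]), Prog.exec_assign_self, if_pos (.inr h1.symm)]
      rfl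
    · rw [Prog.exec_ifEq_of_ne (by rw [e1, e2, ne_eq, ofFin_inj]; exact h1)]
      refine (hval₁.trans hval).trans ?_
      have h1' : ¬ u = l[a] := fun h => h1 h.symm
      simp [h1']

/-- The relaxed map is built above the old one, so all reads see old values, and is moved down
afterwards. The temporary copy accounts for the second square in the space bound. -/
theorem exec_shorten {I : RamInput} {s : RamState Reg} {l : List (Fin n)} {x b : ℕ}
    (hx : x < l.length) {f : Fin n → Fin n → Word} (hk : s.regs k = nat l.length)
    (hr : s.regs r = nat x) (hbase1 : s.regs base1 = nat b)
    (hsp : s.regs sp = nat (b + l.length * l.length)) (hf : StoresMap l b s.memory f) :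
    let s' := shorten.exec I s
    (∀ z < b, s'.memory z = s.memory z) ∧
    s'.used ≤ max s.used (b + l.length * l.length + l.length * l.length) ∧
    StoresMap l b s'.memory (relax l[x] f) ∧
    s'.regs c = s.regs c ⊓ relax l[x] f l[x] l[x] := by
  intro s'
  rw [show s' = shorten.exec I s from rfl]
  simp only [shorten, Prog.block, Prog.exec_seq]
  set body : Prog Reg := .store (entry sp k i j)
        (.min (.mem (entry base1 k i j))
          ((.mem (entry base1 k i r) : Expr Reg) + (.mem (entry base1 k r j) : Expr Reg)))
  set s₁ := Prog.exec I (.loop i k <| .loop j k <| body) s with hs₁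
  have hr₁ : ∀ z, z ∉ [i, j] → s₁.regs z = s.regs z := fun z hz => Prog.exec_regs hz s
  obtain ⟨h1, h2, h3⟩ : (∀ z < b + l.length * l.length, s₁.memory z = s.memory z) ∧
      s₁.used ≤ max s.used (b + l.length * l.length + l.length * l.length) ∧
      StoresMap l (b + l.length * l.length) s₁.memory (relax l[x] f) := by
    refine exec_fill (fun y z hy hz => relax l[x] f l[y] l[z]) hk (by decide) (by decide) ?_
    intro y z hy hz t hr' hi hj hmem
    replace hr' : ∀ z, z ∉ [i, j] → t.regs z = s.regs z := hr'
    have hk' := (hr' k (by decide)).trans hk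
    have hrr := (hr' r (by decide)).trans hr
    have hb' := (hr' base1 (by decide)).trans hbase1
    have hsp' := (hr' sp (by decide)).trans hsp
    have hlt := @mul_add_lt_mul
    have hread : ∀ y z (hy : y < l.length) (hz : z < l.length),
        t.memory (b + y * l.length + z) = f l[y] l[z] := by
      intro y z hy hz
      rw [hmem _ (by have := hlt hy hz; omega), hf y z hy hz]
    have e1 : (Expr.mem (entry base1 k i j)).eval I t = f l[y] l[z] := by
      change t.memory (Word.toNat ((entry base1 k i j).eval I t)) = _
      rw [eval_entry hb' hk' hi hj, toNat_nat, hread y z hy hz]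
    have e2 : (Expr.mem (entry base1 k i r)).eval I t = f l[y] l[x] := by
      change t.memory (Word.toNat ((entry base1 k i r).eval I t)) = _
      rw [eval_entry hb' hk' hi hrr, toNat_nat, hread y x hy hx]
    have e3 : (Expr.mem (entry base1 k r j)).eval I t = f l[x] l[z] := by
      change t.memory (Word.toNat ((entry base1 k r j).eval I t)) = _
      rw [eval_entry hb' hk' hrr hj, toNat_nat, hread x z hx hz]
    rw [Prog.exec, eval_entry hsp' hk' hi hj, toNat_nat]
    refine ⟨?_, rfl⟩
    change Function.update t.memory _ ((Expr.mem (entry base1 k i j)).eval I t ⊓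
      ((Expr.mem (entry base1 k i r)).eval I t + (Expr.mem (entry base1 k r j)).eval I t)) = _
    rw [e1, e2, e3]
    rfl
  obtain ⟨h4, h5, h6⟩ := exec_moveDown (I := I) ((hr₁ k (by decide)).trans hk)
    ((hr₁ base1 (by decide)).trans hbase1) ((hr₁ sp (by decide)).trans hsp) (Nat.le_add_right _ _)
  set s₂ := moveDown.exec I s₁ with hs₂
  have hr₂ : ∀ z, z ∉ [i, j] → s₂.regs z = s.regs z := by
    intro z hz
    rw [hs₂, Prog.exec_regs (by simp [moveDown, Prog.writes] at hz ⊢; tauto), hr₁ z hz]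
  have hf₂ : StoresMap l b s₂.memory (relax l[x] f) := h3.congr h6
  refine ⟨fun z hz => (h4 z hz).trans (h1 z (by omega)), ?_, hf₂, ?_⟩
  · change s₂.used ≤ _
    refine h5.trans (max_le h2 (le_max_of_le_right (by omega)))
  · change Function.update s₂.regs c (s₂.regs c ⊓ (Expr.mem (entry base1 k r r)).eval I s₂) c = _
    have e : (Expr.mem (entry base1 k r r)).eval I s₂ = relax l[x] f l[x] l[x] := by
      change s₂.memory (Word.toNat ((entry base1 k r r).eval I s₂)) = _
      rw [eval_entry ((hr₂ base1 (by decide)).trans hbase1) ((hr₂ k (by decide)).trans hk)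
        ((hr₂ r (by decide)).trans hr) ((hr₂ r (by decide)).trans hr), toNat_nat, hf₂ x x hx hx]
    rw [Function.update_self, e, hr₂ c (by decide)]

end MinCycle

/-! ### Elimination of the nodes of a bag -/

namespace TreeDecomposition.Listing

variable {n : ℕ} {G : WeightedDigraph n} {m : ℕ} {D : TreeDecomposition G m} (L : D.Listing)

theorem mem_optNodes_some (i : Fin m) (u : Fin n) : u ∈ L.optNodes (some i) ↔ u ∈ D.bag i :=
  L.mem_nodes i u

theorem mem_optNodes_parent (i : Fin m) (u : Fin n) :
    u ∈ L.optNodes (L.parent i) ↔ ∃ p, D.IsChild p i ∧ u ∈ D.bag p := by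
  cases h : L.parent i with
  | none =>
    simp only [optNodes, Option.elim_none, List.not_mem_nil, false_iff, not_exists, not_and]
    intro p hp
    rw [← L.parent_eq_some, h] at hp
    cases hp
  | some p =>
    rw [mem_optNodes_some]
    constructor
    · exact fun hu => ⟨p, (L.parent_eq_some p i).1 h, hu⟩
    · rintro ⟨p', hp', hu⟩
      rw [← L.parent_eq_some, h, Option.some_inj] at hp'
      exact hp' ▸ hu

theorem length_children_le (hb : D.IsBinary) (i : Fin m) : (L.children i).length ≤ 2 := by
  classical
  rw [← List.toFinset_card_of_nodup (L.children_nodup i), ← Set.ncard_coe_finset]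
  convert hb i using 2
  ext j
  simp [L.mem_children]

/-- The nodes that occur only below `i` and do not belong to the bag `i`, or are among its first
`x` nodes. -/
def eliminated (i : Fin m) (x : ℕ) : Set (Fin n) :=
  {u | u ∈ D.ownNodes i ∧ (u ∉ D.bag i ∨ u ∈ (L.nodes i).take x)}

theorem eliminated_zero (i : Fin m) : L.eliminated i 0 = D.ownNodes i \ D.bag i := by
  ext u
  simp [eliminated]

theorem eliminated_length (i : Fin m) : L.eliminated i (L.nodes i).length = D.ownNodes i := by
  ext u
  simp only [eliminated, List.take_length, L.mem_nodes, Set.mem_ofPred_eq]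
  tauto

/-- A node shared with the parent is not an own node, so skipping it loses nothing. -/
theorem eliminated_succ_of_mem_parent {i : Fin m} {x : ℕ} (hx : x < (L.nodes i).length)
    (h : (L.nodes i)[x] ∈ L.optNodes (L.parent i)) :
    L.eliminated i (x + 1) = L.eliminated i x := by
  obtain ⟨p, hp, hu⟩ := (L.mem_optNodes_parent i _).1 h
  ext u
  simp only [eliminated, List.take_add_one, List.getElem?_eq_getElem hx, Option.toList_some,
    List.mem_append, List.mem_singleton, Set.mem_ofPred_eq]
  constructor
  · rintro ⟨h1, h2⟩
    refine ⟨h1, ?_⟩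
    rcases h2 with h2 | h2 | rfl
    · exact .inl h2
    · exact .inr h2
    · exact absurd hu (notMem_parent_of_mem_ownNodes h1 hp)
  · tauto

theorem eliminated_succ_of_notMem_parent {i : Fin m} {x : ℕ} (hx : x < (L.nodes i).length)
    (h : (L.nodes i)[x] ∉ L.optNodes (L.parent i)) :
    L.eliminated i (x + 1) = insert (L.nodes i)[x] (L.eliminated i x) := by
  have hu : (L.nodes i)[x] ∈ D.ownNodes i := by
    refine mem_ownNodes_of_mem_bag ((L.mem_nodes i _).1 (List.getElem_mem hx)) ?_
    intro p hp hup
    exact h ((L.mem_optNodes_parent i _).2 ⟨p, hp, hup⟩)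
  ext u
  simp only [eliminated, List.take_add_one, List.getElem?_eq_getElem hx, Option.toList_some,
    List.mem_append, List.mem_singleton, Set.mem_ofPred_eq, Set.mem_insert_iff]
  constructor
  · tauto
  · rintro (rfl | h)
    · exact ⟨hu, .inr (.inr rfl)⟩
    · tauto

end TreeDecomposition.Listing

namespace MinCycle

open Reg

variable {n : ℕ} {G : WeightedDigraph n} {m : ℕ} {D : TreeDecomposition G m} {L : D.Listing}

/-- The loop of `examine` that eliminates the nodes whose root bag is `cur`. -/
theorem exec_eliminate {s : RamState Reg} {B : Fin m} {a U l lmax : ℕ} {f : Fin n → Fin n → Word}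
    (hcur : s.regs cur = ofFin B) (hk : s.regs k = nat (L.nodes B).length)
    (hbase1 : s.regs base1 = nat a)
    (hsp : s.regs sp = nat (a + (L.nodes B).length * (L.nodes B).length))
    (hU : a + (L.nodes B).length * (L.nodes B).length +
      (L.nodes B).length * (L.nodes B).length ≤ U) (hused : s.used ≤ U)
    (hf : StoresMap (L.nodes B) a s.memory f) (hfr : G.IsRealized (D.bag B) l f)
    (hfs : G.IsShort (D.bag B) (D.ownNodes B \ D.bag B) f)
    (hc : G.CoversCycles (D.ownNodes B \ D.bag B) (s.regs c))
    (hcw : G.IsClosedWalkWeight lmax (s.regs c)) (hl : 2 ^ (L.nodes B).length * l ≤ lmax) :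
    let s' := (Prog.loop r k <| .block [testRoot, .ifEq isRoot (lit 1) shorten .skip]).exec
      L.toInput s
    (∀ z < a, s'.memory z = s.memory z) ∧ s'.used ≤ U ∧ s'.regs c ≤ s.regs c ∧
    G.IsClosedWalkWeight lmax (s'.regs c) ∧ G.CoversCycles (D.ownNodes B) (s'.regs c) ∧
    ∃ f, StoresMap (L.nodes B) a s'.memory f ∧
      G.IsRealized (D.bag B) (2 ^ (L.nodes B).length * l) f ∧
      G.IsShort (D.bag B) (D.ownNodes B) f := by
  intro s'
  have key := Prog.exec_loop (I := L.toInput) (s := s) (r := r) (e := k) (p := .block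
    [testRoot, .ifEq isRoot (lit 1) shorten .skip]) (fun x t =>
    (∀ z < a, t.memory z = s.memory z) ∧ t.used ≤ U ∧ t.regs c ≤ s.regs c ∧
    G.IsClosedWalkWeight lmax (t.regs c) ∧ G.CoversCycles (L.eliminated B x) (t.regs c) ∧
    ∃ f, StoresMap (L.nodes B) a t.memory f ∧ G.IsRealized (D.bag B) (2 ^ x * l) f ∧
      G.IsShort (D.bag B) (L.eliminated B x) f) hk ?_ ?_
  · rw [L.eliminated_length] at key
    exact key
  · rw [L.eliminated_zero, pow_zero, one_mul]
    exact ⟨fun _ _ => rfl, hused, le_rfl, hcw, hc, f, hf, hfr, hfs⟩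
  rintro x hx t ht ⟨h1, h2, h3, h4, h5, g, h6, h7, h8⟩
  set t₁ := (t.setReg r (nat x)).tick 1 with ht₁
  simp only [Prog.block, Prog.exec_seq]
  set t₂ := testRoot.exec L.toInput t₁ with ht₂
  have hrr₁ : t₁.regs r = nat x := Prog.setReg_tick_regs_self _ _ _ _
  have hr₁ : ∀ z, z ≠ r → t₁.regs z = t.regs z := fun z hz =>
    Prog.setReg_tick_regs_of_ne hz _ _ _
  have hr₂ : ∀ z, z ∉ testRoot.writes → t₂.regs z = t₁.regs z := fun z hz =>
    Prog.exec_regs hz t₁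
  have hm₂ := Prog.exec_storeFree (I := L.toInput) (p := testRoot)
    (by simp [testRoot, Prog.block, Prog.storeFree]) t₁
  rw [← ht₂] at hm₂
  have hcur₁ : t₁.regs cur = ofFin B := by
    rw [hr₁ _ (by decide), ht _ (by decide), hcur]
  have hroot := exec_testRoot hx hcur₁ hrr₁
  rw [← ht₂] at hroot
  have hc₂ : t₂.regs c = t.regs c := by
    rw [hr₂ _ (by decide), hr₁ _ (by decide)]
  have hxB : (L.nodes B)[x] ∈ D.bag B := (L.mem_nodes B _).1 (List.getElem_mem hx)
  have hmem₂ : t₂.memory = t.memory := hm₂.1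
  have hused₂ : t₂.used = t.used := hm₂.2
  have hpow : 2 ^ (x + 1) * l = 2 * (2 ^ x * l) := by ring
  by_cases hp : (L.nodes B)[x] ∈ L.optNodes (L.parent B)
  · rw [if_pos hp] at hroot
    rw [Prog.exec_ifEq_of_ne (by change t₂.regs isRoot ≠ nat 1; rw [hroot]; simp),
      L.eliminated_succ_of_mem_parent hx hp]
    change (∀ z < a, t₂.memory z = s.memory z) ∧ t₂.used ≤ U ∧ t₂.regs c ≤ s.regs c ∧
      G.IsClosedWalkWeight lmax (t₂.regs c) ∧ G.CoversCycles (L.eliminated B x) (t₂.regs c) ∧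
      ∃ f, StoresMap (L.nodes B) a t₂.memory f ∧ G.IsRealized (D.bag B) (2 ^ (x + 1) * l) f ∧
        G.IsShort (D.bag B) (L.eliminated B x) f
    rw [hmem₂, hused₂, hc₂]
    exact ⟨h1, h2, h3, h4, h5, g, h6, h7.mono (by omega), h8⟩
  · rw [if_neg hp] at hroot
    rw [Prog.exec_ifEq_of_eq (by change t₂.regs isRoot = nat 1; exact hroot),
      L.eliminated_succ_of_notMem_parent hx hp]
    generalize Expr.cost (.reg isRoot) + Expr.cost (lit 1) + 1 = τ
    have hregs : ∀ z, z ∉ [r, isRoot, p, i, j, c] → (t₂.tick τ).regs z = s.regs z := by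
      intro z hz
      change t₂.regs z = _
      simp only [List.mem_cons, not_or] at hz
      rw [hr₂ z (by simp [testRoot, Prog.block, Prog.writes, hz]), hr₁ z hz.1,
        ht z (by simp [testRoot, shorten, moveDown, Prog.block, Prog.writes, hz])]
    have hrr₂ : (t₂.tick τ).regs r = nat x := by
      change t₂.regs r = _
      rw [hr₂ _ (by decide), hrr₁]
    obtain ⟨g1, g2, g3, g4⟩ := exec_shorten (I := L.toInput) (s := t₂.tick τ) hx
      ((hregs k (by decide)).trans hk) hrr₂ ((hregs base1 (by decide)).trans hbase1)
      ((hregs sp (by decide)).trans hsp) (hmem₂ ▸ h6)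
    have hrel := h7.relax hxB
    rw [← hpow] at hrel
    -- Each earlier node doubled the edge bound at most once, and `x + 1` does not exceed the number
    -- of nodes of the bag.
    have hle : 2 ^ (x + 1) * l ≤ lmax :=
      (Nat.mul_le_mul_right l (Nat.pow_le_pow_right (by omega) hx)).trans hl
    have hc₂' : (t₂.tick τ).regs c = t.regs c := hc₂
    have hused₂' : (t₂.tick τ).used = t.used := hused₂
    have hmem₂' : (t₂.tick τ).memory = t.memory := hmem₂
    rw [hc₂'] at g4
    rw [hused₂'] at g2
    rw [hmem₂'] at g1
    refine ⟨fun z hz => (g1 z hz).trans (h1 z hz), g2.trans (max_le h2 hU), ?_, ?_, ?_, _, g3,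
      hrel, h8.relax hxB⟩
    · exact g4.le.trans (inf_le_left.trans h3)
    · exact g4 ▸ h4.inf ((hrel.mono hle).diag hxB)
    · exact g4 ▸ h5.relax h8 hxB

end MinCycle

/-! ### Examination of a bag and single moves -/

namespace MinCycle

open Reg

variable {n : ℕ} {G : WeightedDigraph n} {m : ℕ} {D : TreeDecomposition G m} {L : D.Listing}

/-- The map of the bag `i` is stored at `base`, all its values are weights of walks with at most
`l` edges, and it takes all walks into account whose interior nodes occur only below `i`. -/
def HasLocalDist (L : D.Listing) (i : Fin m) (base l : ℕ) (memory : ℕ → Word) : Prop :=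
  ∃ f, StoresMap (L.nodes i) base memory f ∧ G.IsRealized (D.bag i) l f ∧
    G.IsShort (D.bag i) (D.ownNodes i) f

theorem HasLocalDist.congr {i : Fin m} {base l : ℕ} {mem mem' : ℕ → Word}
    (h : HasLocalDist L i base l mem)
    (e : ∀ z < base + (L.nodes i).length * (L.nodes i).length, mem' z = mem z) :
    HasLocalDist L i base l mem' := by
  obtain ⟨f, h1, h2⟩ := h
  exact ⟨f, h1.congr fun z hz => e _ (by omega), h2⟩

theorem isRealized_combinedMap {B : Set (Fin n)} {l : ℕ} {o₁ o₂ : Option (Fin m)}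
    {f₁ f₂ : Fin n → Fin n → Word} (h₁ : ∀ j, o₁ = some j → G.IsRealized (D.bag j) l f₁)
    (h₂ : ∀ j, o₂ = some j → G.IsRealized (D.bag j) l f₂) (hl0 : 1 ≤ l) :
    G.IsRealized B l (combinedMap G (L.optNodes o₁) (L.optNodes o₂) f₁ f₂) := by
  classical
  have hrest : ∀ (o : Option (Fin m)) (f : Fin n → Fin n → Word),
      (∀ j, o = some j → G.IsRealized (D.bag j) l f) → ∀ u v,
      restrict (L.optNodes o) f u v = ⊤ ∨ ∃ ys w, G.HasWalk u ys v w ∧ ys.length + 1 ≤ l ∧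
        restrict (L.optNodes o) f u v = (w : ℤ) := by
    intro o f hf u v
    by_cases huv : u ∈ L.optNodes o ∧ v ∈ L.optNodes o
    · rw [restrict, if_pos huv]
      cases o with
      | none => simp [TreeDecomposition.Listing.optNodes] at huv
      | some j =>
        rw [L.mem_optNodes_some, L.mem_optNodes_some] at huv
        exact hf j rfl u huv.1 v huv.2
    · exact .inl (if_neg huv)
  intro u _ v _
  rw [combinedMap]
  rcases min_choice ((if G.Adj u v then (G.wt u v : WithTop ℤ) else ⊤) ⊓
    restrict (L.optNodes o₁) f₁ u v) (restrict (L.optNodes o₂) f₂ u v) with e | e <;> rw [e]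
  · rcases min_choice (if G.Adj u v then (G.wt u v : WithTop ℤ) else ⊤)
      (restrict (L.optNodes o₁) f₁ u v) with e | e <;> rw [e]
    · by_cases h : G.Adj u v
      · exact .inr ⟨[], _, .edge h, hl0, if_pos h⟩
      · exact .inl (if_neg h)
    · exact hrest o₁ f₁ h₁ u v
  · exact hrest o₂ f₂ h₂ u v

theorem isShort_combinedMap {B : Fin m} {o₁ o₂ : Option (Fin m)}
    {f₁ f₂ : Fin n → Fin n → Word}
    (h₁ : ∀ j, o₁ = some j → G.IsShort (D.bag j) (D.ownNodes j) f₁)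
    (h₂ : ∀ j, o₂ = some j → G.IsShort (D.bag j) (D.ownNodes j) f₂)
    (ho : ∀ j, D.IsChild B j ↔ o₁ = some j ∨ o₂ = some j) :
    G.IsShort (D.bag B) (D.ownNodes B \ D.bag B)
      (combinedMap G (L.optNodes o₁) (L.optNodes o₂) f₁ f₂) := by
  classical
  refine TreeDecomposition.isShort_of_children ?_ ?_
  · intro u _ v _ h
    refine inf_le_left.trans (inf_le_left.trans ?_)
    rw [if_pos h]
  · intro j hj
    rcases (ho j).1 hj with e | e
    · refine ⟨f₁, h₁ j e, fun u _ v _ hu hv => ?_⟩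
      refine inf_le_left.trans (inf_le_right.trans ?_)
      rw [restrict, if_pos]
      rw [e, L.mem_optNodes_some, L.mem_optNodes_some]
      exact ⟨hu, hv⟩
    · refine ⟨f₂, h₂ j e, fun u _ v _ hu hv => ?_⟩
      refine inf_le_right.trans ?_
      rw [restrict, if_pos]
      rw [e, L.mem_optNodes_some, L.mem_optNodes_some]
      exact ⟨hu, hv⟩

/-- The loop of `examine`. -/
def eliminate : Prog Reg :=
  .loop r k <| .block [testRoot, .ifEq isRoot (lit 1) shorten .skip]

/-- The children's maps lie side by side at the top of the stack, so subtracting the squares of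
their sizes from `sp` recovers their addresses. A null child contributes zero. -/
theorem exec_examine_sizes {s : RamState Reg} {B : Fin m} {a : ℕ} {o₁ o₂ : Option (Fin m)}
    (hcur : s.regs cur = ofFin B) (hch1 : s.regs ch1 = ofOption o₁)
    (hch2 : s.regs ch2 = ofOption o₂)
    (hsp : s.regs sp = nat (a + (L.optNodes o₁).length * (L.optNodes o₁).length + (L.optNodes o₂).length * (L.optNodes o₂).length)) :
    ∃ s₅ : RamState Reg, examine.exec L.toInput s = (Prog.block [combine, moveDown,
        .assign sp ((base1 : Expr Reg) + (k : Expr Reg) * (k : Expr Reg)), eliminate]).exec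
          L.toInput s₅ ∧
      s₅.memory = s.memory ∧ s₅.used = s.used ∧
      (∀ z, z ∉ [k, k1, k2, base2, base1] → s₅.regs z = s.regs z) ∧
      s₅.regs k = nat (L.nodes B).length ∧ s₅.regs k1 = nat (L.optNodes o₁).length ∧ s₅.regs k2 = nat (L.optNodes o₂).length ∧
      s₅.regs base1 = nat a ∧ s₅.regs base2 = nat (a + (L.optNodes o₁).length * (L.optNodes o₁).length) := by
  simp only [examine, eliminate, Prog.block, Prog.exec_seq]
  set s₁ := Prog.exec L.toInput (.assign k (.bagSize cur)) s with hs₁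
  set s₂ := Prog.exec L.toInput (.assign k1 (.bagSize ch1)) s₁ with hs₂
  set s₃ := Prog.exec L.toInput (.assign k2 (.bagSize ch2)) s₂ with hs₃
  set s₄ := Prog.exec L.toInput
    (.assign base2 ((sp : Expr Reg) - (k2 : Expr Reg) * (k2 : Expr Reg))) s₃ with hs₄
  set s₅ := Prog.exec L.toInput
    (.assign base1 ((base2 : Expr Reg) - (k1 : Expr Reg) * (k1 : Expr Reg))) s₄ with hs₅
  have r₁ : ∀ z, z ∉ [k] → s₁.regs z = s.regs z := fun z hz => Prog.exec_regs hz s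
  have r₂ : ∀ z, z ∉ [k1] → s₂.regs z = s₁.regs z := fun z hz => Prog.exec_regs hz s₁
  have r₃ : ∀ z, z ∉ [k2] → s₃.regs z = s₂.regs z := fun z hz => Prog.exec_regs hz s₂
  have r₄ : ∀ z, z ∉ [base2] → s₄.regs z = s₃.regs z := fun z hz => Prog.exec_regs hz s₃
  have r₅ : ∀ z, z ∉ [base1] → s₅.regs z = s₄.regs z := fun z hz => Prog.exec_regs hz s₄
  have hk₁ : s₁.regs k = nat (L.nodes B).length := by
    rw [hs₁, Prog.exec_assign_self]
    change L.toInput.bagSize (s.regs cur) = _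
    rw [hcur, L.bagSize_ofFin]
  have hk₂ : s₂.regs k1 = nat (L.optNodes o₁).length := by
    rw [hs₂, Prog.exec_assign_self]
    change L.toInput.bagSize (s₁.regs ch1) = _
    rw [r₁ _ (by decide), hch1, L.bagSize_ofOption]
  have hk₃ : s₃.regs k2 = nat (L.optNodes o₂).length := by
    rw [hs₃, Prog.exec_assign_self]
    change L.toInput.bagSize (s₂.regs ch2) = _
    rw [r₂ _ (by decide), r₁ _ (by decide), hch2, L.bagSize_ofOption]
  have hb₄ : s₄.regs base2 = nat (a + (L.optNodes o₁).length * (L.optNodes o₁).length) := by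
    rw [hs₄, Prog.exec_assign_self]
    change WithTop.map₂ (fun a b : ℤ => a - b) (s₃.regs sp)
      (WithTop.map₂ (fun a b : ℤ => a * b) (s₃.regs k2) (s₃.regs k2)) = _
    rw [hk₃, nat_mul, r₃ _ (by decide), r₂ _ (by decide), r₁ _ (by decide), hsp,
      nat_sub (by omega)]
    congr 1
    omega
  have hb₅ : s₅.regs base1 = nat a := by
    rw [hs₅, Prog.exec_assign_self]
    change WithTop.map₂ (fun a b : ℤ => a - b) (s₄.regs base2)
      (WithTop.map₂ (fun a b : ℤ => a * b) (s₄.regs k1) (s₄.regs k1)) = _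
    rw [hb₄, r₄ k1 (by decide), r₃ k1 (by decide), hk₂, nat_mul, nat_sub (by omega)]
    congr 1
    omega
  have r : ∀ z, z ∉ [k, k1, k2, base2, base1] → s₅.regs z = s.regs z := by
    intro z hz
    simp only [List.mem_cons, not_or] at hz
    rw [r₅ z (by simp [hz]), r₄ z (by simp [hz]), r₃ z (by simp [hz]), r₂ z (by simp [hz]),
      r₁ z (by simp [hz])]
  have hk₅ : s₅.regs k = nat (L.nodes B).length := by
    rw [r₅ _ (by decide), r₄ _ (by decide), r₃ _ (by decide), r₂ _ (by decide), hk₁]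
  have hk1₅ : s₅.regs k1 = nat (L.optNodes o₁).length := by
    rw [r₅ _ (by decide), r₄ _ (by decide), r₃ _ (by decide), hk₂]
  have hk2₅ : s₅.regs k2 = nat (L.optNodes o₂).length := by
    rw [r₅ _ (by decide), r₄ _ (by decide), hk₃]
  have hb2₅ : s₅.regs base2 = nat (a + (L.optNodes o₁).length * (L.optNodes o₁).length) := by
    rw [r₅ _ (by decide), hb₄]
  exact ⟨s₅, rfl, rfl, rfl, r, hk₅, hk1₅, hk2₅, hb₅, hb2₅⟩

theorem exec_examine_combine {s : RamState Reg} {B : Fin m} {a U : ℕ} {o₁ o₂ : Option (Fin m)}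
    {f₁ f₂ : Fin n → Fin n → Word}
    (hcur : s.regs cur = ofFin B) (hch1 : s.regs ch1 = ofOption o₁)
    (hch2 : s.regs ch2 = ofOption o₂)
    (hsp : s.regs sp = nat (a + (L.optNodes o₁).length * (L.optNodes o₁).length + (L.optNodes o₂).length * (L.optNodes o₂).length))
    (hU : a + (L.optNodes o₁).length * (L.optNodes o₁).length + (L.optNodes o₂).length * (L.optNodes o₂).length + (L.nodes B).length * (L.nodes B).length ≤ U) (hused : s.used ≤ U)
    (hf₁ : StoresMap (L.optNodes o₁) a s.memory f₁)
    (hf₂ : StoresMap (L.optNodes o₂) (a + (L.optNodes o₁).length * (L.optNodes o₁).length) s.memory f₂) :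
    ∃ s₈ : RamState Reg, examine.exec L.toInput s = eliminate.exec L.toInput s₈ ∧
      (∀ z < a, s₈.memory z = s.memory z) ∧ s₈.used ≤ U ∧ s₈.regs k = nat (L.nodes B).length ∧
      s₈.regs base1 = nat a ∧ s₈.regs sp = nat (a + (L.nodes B).length * (L.nodes B).length) ∧ s₈.regs c = s.regs c ∧
      s₈.regs cur = ofFin B ∧ StoresMap (L.nodes B) a s₈.memory
        (combinedMap G (L.optNodes o₁) (L.optNodes o₂) f₁ f₂) := by
  obtain ⟨s₅, hex, hm₅, hu₅, r, hk₅, hk1₅, hk2₅, hb₅, hb2₅⟩ :=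
    exec_examine_sizes hcur hch1 hch2 hsp
  rw [hex]
  simp only [Prog.block, Prog.exec_seq]
  rw [← hu₅] at hused
  obtain ⟨c1, c2, c3⟩ := exec_combine (s := s₅) ((r _ (by decide)).trans hcur) hk₅
    ((r _ (by decide)).trans hch1) hk1₅ hb₅ (hm₅ ▸ hf₁) (by omega)
    ((r _ (by decide)).trans hch2) hk2₅ hb2₅ (hm₅ ▸ hf₂) le_rfl
    ((r _ (by decide)).trans hsp)
  set s₆ := combine.exec L.toInput s₅ with hs₆
  have r₆ : ∀ z, z ∉ combine.writes → s₆.regs z = s₅.regs z := fun z hz => Prog.exec_regs hz s₅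
  obtain ⟨d1, d2, d3⟩ := exec_moveDown (I := L.toInput) (s := s₆)
    ((r₆ k (by decide)).trans hk₅) ((r₆ base1 (by decide)).trans hb₅)
    ((r₆ sp (by decide)).trans ((r sp (by decide)).trans hsp)) (by omega)
  set s₇ := moveDown.exec L.toInput s₆ with hs₇
  have r₇ : ∀ z, z ∉ moveDown.writes → s₇.regs z = s₆.regs z := fun z hz => Prog.exec_regs hz s₆
  have hf₇ : StoresMap (L.nodes B) a s₇.memory _ := c3.congr d3
  set s₈ := Prog.exec L.toInput
    (.assign sp ((base1 : Expr Reg) + (k : Expr Reg) * (k : Expr Reg))) s₇ with hs₈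
  have r₈ : ∀ z, z ∉ [sp] → s₈.regs z = s₇.regs z := fun z hz => Prog.exec_regs hz s₇
  have hk₈ : s₈.regs k = nat (L.nodes B).length := by
    rw [r₈ _ (by decide), r₇ _ (by decide), r₆ _ (by decide), hk₅]
  have hb₈ : s₈.regs base1 = nat a := by
    rw [r₈ _ (by decide), r₇ _ (by decide), r₆ _ (by decide), hb₅]
  have hsp₈ : s₈.regs sp = nat (a + (L.nodes B).length * (L.nodes B).length) := by
    rw [hs₈, Prog.exec_assign_self]
    change s₇.regs base1 + WithTop.map₂ (fun a b : ℤ => a * b) (s₇.regs k) (s₇.regs k) = _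
    rw [r₇ _ (by decide), r₇ k (by decide), r₆ _ (by decide), r₆ k (by decide), hb₅, hk₅, nat_mul,
      nat_add]
  have hc₈ : s₈.regs c = s.regs c := by
    rw [r₈ _ (by decide), r₇ _ (by decide), r₆ _ (by decide), r _ (by decide)]
  have hcur₈ : s₈.regs cur = ofFin B := by
    rw [r₈ _ (by decide), r₇ _ (by decide), r₆ _ (by decide), r _ (by decide), hcur]
  have hu₈ : s₈.used ≤ U := by
    change s₇.used ≤ U
    exact d2.trans (max_le (c2.trans (max_le hused hU)) (by omega))
  refine ⟨s₈, rfl, fun z hz => ?_, hu₈, hk₈, hb₈, hsp₈, hc₈, hcur₈, hf₇⟩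
  rw [← hm₅, ← c1 z (by omega)]
  exact d1 z hz

theorem exec_examine {s : RamState Reg} {B : Fin m} {a U l lmax : ℕ} {o₁ o₂ : Option (Fin m)}
    (hcur : s.regs cur = ofFin B) (hch1 : s.regs ch1 = ofOption o₁)
    (hch2 : s.regs ch2 = ofOption o₂)
    (hsp : s.regs sp = nat (a + (L.optNodes o₁).length * (L.optNodes o₁).length +
      (L.optNodes o₂).length * (L.optNodes o₂).length))
    (hU : a + (L.optNodes o₁).length * (L.optNodes o₁).length +
      (L.optNodes o₂).length * (L.optNodes o₂).length +
      (L.nodes B).length * (L.nodes B).length ≤ U)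
    (hU' : a + (L.nodes B).length * (L.nodes B).length +
      (L.nodes B).length * (L.nodes B).length ≤ U)
    (hused : s.used ≤ U)
    (ho : ∀ j, D.IsChild B j ↔ o₁ = some j ∨ o₂ = some j)
    (h₁ : ∀ j, o₁ = some j → HasLocalDist L j a l s.memory)
    (h₂ : ∀ j, o₂ = some j → HasLocalDist L j
      (a + (L.optNodes o₁).length * (L.optNodes o₁).length) l s.memory)
    (hc : ∀ j, D.IsChild B j → G.CoversCycles (D.ownNodes j) (s.regs c))
    (hcw : G.IsClosedWalkWeight lmax (s.regs c)) (hl0 : 1 ≤ l)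
    (hl : 2 ^ (L.nodes B).length * l ≤ lmax) :
    let s' := examine.exec L.toInput s
    s'.regs sp = nat (a + (L.nodes B).length * (L.nodes B).length) ∧
    (∀ z < a, s'.memory z = s.memory z) ∧ s'.used ≤ U ∧ s'.regs c ≤ s.regs c ∧
    G.IsClosedWalkWeight lmax (s'.regs c) ∧ G.CoversCycles (D.ownNodes B) (s'.regs c) ∧
    HasLocalDist L B a (2 ^ (L.nodes B).length * l) s'.memory := by
  have hopt : ∀ (o : Option (Fin m)) (b : ℕ),
      (∀ j, o = some j → HasLocalDist L j b l s.memory) →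
      ∃ f, StoresMap (L.optNodes o) b s.memory f ∧ ∀ j, o = some j →
        G.IsRealized (D.bag j) l f ∧ G.IsShort (D.bag j) (D.ownNodes j) f := by
    intro o b h
    cases o with
    -- A null child has no rows, so any map would do here.
    | none => exact ⟨fun _ _ => ⊤, fun x y hx => absurd hx (by simp [TreeDecomposition.Listing.optNodes]), by simp⟩
    | some j =>
      obtain ⟨f, hf, hf'⟩ := h j rfl
      refine ⟨f, hf, ?_⟩
      rintro j' ⟨⟩
      exact hf'
  obtain ⟨f₁, hf₁, hs₁⟩ := hopt o₁ _ h₁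
  obtain ⟨f₂, hf₂, hs₂⟩ := hopt o₂ _ h₂
  obtain ⟨s₈, hex, hm₈, hu₈, hk₈, hb₈, hsp₈, hc₈, hcur₈, hf₈⟩ :=
    exec_examine_combine hcur hch1 hch2 hsp hU hused hf₁ hf₂
  obtain ⟨e1, e2, e3, e4, e5, e6⟩ := exec_eliminate (s := s₈) hcur₈ hk₈ hb₈ hsp₈ hU' hu₈ hf₈
    (isRealized_combinedMap (fun j hj => (hs₁ j hj).1) (fun j hj => (hs₂ j hj).1) hl0)
    (isShort_combinedMap (fun j hj => (hs₁ j hj).2) (fun j hj => (hs₂ j hj).2) ho)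
    (hc₈.symm ▸ TreeDecomposition.coversCycles_of_children hc) (hc₈.symm ▸ hcw) hl
  rw [hex]
  refine ⟨?_, fun z hz => (e1 z hz).trans (hm₈ z hz), e2, hc₈ ▸ e3, e4, e5, e6⟩
  rw [← hsp₈]
  exact Prog.exec_regs (p := eliminate) (by decide) s₈

/-- The first part of a move: the choice of the next bag to descend to. -/
theorem exec_move {s : RamState Reg} {B : Fin m} (hcur : s.regs cur = ofFin B) :
    ∃ s', move.exec L.toInput s = (Prog.ifEq next (.const ⊤)
        (.block [examine, .assign prev cur, .assign cur (.parent cur)])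
        (.block [.assign prev cur, .assign cur next])).exec L.toInput s' ∧
      s'.memory = s.memory ∧ s'.used = s.used ∧
      (∀ z, z ∉ [ch1, ch2, next] → s'.regs z = s.regs z) ∧
      s'.regs ch1 = ofOption (L.children B)[0]? ∧ s'.regs ch2 = ofOption (L.children B)[1]? ∧
      s'.regs next = if s.regs prev = ofOption (L.parent B) then ofOption (L.children B)[0]? else
        if s.regs prev = ofOption (L.children B)[0]? then ofOption (L.children B)[1]? else ⊤ := by
  simp only [move, Prog.block, Prog.exec_seq]
  set s₁ := Prog.exec L.toInput (.assign ch1 (.child cur (lit 0))) s with hs₁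
  set s₂ := Prog.exec L.toInput (.assign ch2 (.child cur (lit 1))) s₁ with hs₂
  set choose : Prog Reg := .ifEq prev (.parent cur) (.assign next ch1)
    (.ifEq prev ch1 (.assign next ch2) (.assign next (.const ⊤)))
  have r₁ : ∀ z, z ∉ [ch1] → s₁.regs z = s.regs z := fun z hz => Prog.exec_regs hz s
  have r₂ : ∀ z, z ∉ [ch2] → s₂.regs z = s₁.regs z := fun z hz => Prog.exec_regs hz s₁
  have r₃ : ∀ z, z ∉ choose.writes → (choose.exec L.toInput s₂).regs z = s₂.regs z :=
    fun z hz => Prog.exec_regs hz s₂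
  have hm := Prog.exec_storeFree (I := L.toInput) (p := choose)
    (by simp [choose, Prog.storeFree]) s₂
  have h1 : s₁.regs ch1 = ofOption (L.children B)[0]? := by
    rw [hs₁, Prog.exec_assign_self]
    change L.toInput.child (s.regs cur) (nat 0) = _
    rw [hcur, L.child_ofFin]
  have h2 : s₂.regs ch2 = ofOption (L.children B)[1]? := by
    rw [hs₂, Prog.exec_assign_self]
    change L.toInput.child (s₁.regs cur) (nat 1) = _
    rw [r₁ _ (by decide), hcur, L.child_ofFin]
  refine ⟨choose.exec L.toInput s₂, rfl, hm.1, hm.2, ?_, ?_, ?_, ?_⟩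
  · intro z hz
    simp only [List.mem_cons, not_or] at hz
    rw [r₃ z (by simp [choose, Prog.writes, hz]), r₂ z (by simp [hz]), r₁ z (by simp [hz])]
  · rw [r₃ _ (by decide), r₂ _ (by decide), h1]
  · rw [r₃ _ (by decide), h2]
  have hp : ∀ τ, Expr.eval L.toInput (s₂.tick τ) prev = s.regs prev := by
    intro τ
    change s₂.regs prev = _
    rw [r₂ _ (by decide), r₁ _ (by decide)]
  have hpar : ∀ τ, Expr.eval L.toInput (s₂.tick τ) (.parent cur) = ofOption (L.parent B) := by
    intro τ
    change L.toInput.parent (s₂.regs cur) = _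
    rw [r₂ _ (by decide), r₁ _ (by decide), hcur, L.parent_ofFin]
  have hc1 : ∀ τ, Expr.eval L.toInput (s₂.tick τ) ch1 = ofOption (L.children B)[0]? := by
    intro τ
    change s₂.regs ch1 = _
    rw [r₂ _ (by decide), h1]
  have hp0 : Expr.eval L.toInput s₂ prev = s.regs prev := hp 0
  have hpar0 : Expr.eval L.toInput s₂ (.parent cur) = ofOption (L.parent B) := hpar 0
  split_ifs with i1 i2
  · rw [Prog.exec_ifEq_of_eq (hp0.trans (i1.trans hpar0.symm)), Prog.exec_assign_self, hc1]
  · rw [Prog.exec_ifEq_of_ne (fun e => i1 (hp0.symm.trans (e.trans hpar0))),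
      Prog.exec_ifEq_of_eq (by rw [hp, hc1, i2]), Prog.exec_assign_self]
    exact h2
  · rw [Prog.exec_ifEq_of_ne (fun e => i1 (hp0.symm.trans (e.trans hpar0))),
      Prog.exec_ifEq_of_ne (by rw [hp, hc1]; exact i2), Prog.exec_assign_self]
    rfl

/-- A move that descends to the bag `j`. -/
theorem exec_move_descend {s : RamState Reg} {B j : Fin m} (hcur : s.regs cur = ofFin B)
    (hnext : (if s.regs prev = ofOption (L.parent B) then ofOption (L.children B)[0]? else
        if s.regs prev = ofOption (L.children B)[0]? then ofOption (L.children B)[1]? else ⊤)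
      = ofFin j) :
    let s' := move.exec L.toInput s
    s'.regs cur = ofFin j ∧ s'.regs prev = ofFin B ∧ s'.regs sp = s.regs sp ∧
    s'.regs c = s.regs c ∧ s'.memory = s.memory ∧ s'.used = s.used := by
  obtain ⟨s₁, h, hm, hu, hr, -, -, hn⟩ := exec_move (L := L) hcur
  rw [hnext] at hn
  rw [h, Prog.exec_ifEq_of_ne (by change s₁.regs next ≠ ⊤; rw [hn]; simp)]
  generalize Expr.cost (.reg next) + Expr.cost (.const ⊤ : Expr Reg) + 1 = τ
  simp only [Prog.block, Prog.exec_seq]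
  set s₂ := Prog.exec L.toInput (.assign prev cur) (s₁.tick τ) with hs₂
  have r₂ : ∀ z, z ∉ [prev] → s₂.regs z = s₁.regs z := fun z hz => Prog.exec_regs hz (s₁.tick τ)
  have r₃ : ∀ z, z ∉ [cur] → (Prog.exec L.toInput (.assign cur next) s₂).regs z = s₂.regs z :=
    fun z hz => Prog.exec_regs hz s₂
  refine ⟨?_, ?_, ?_, ?_, hm, hu⟩
  · rw [Prog.exec, Prog.exec_assign_self]
    change s₂.regs next = _
    rw [r₂ _ (by decide), hn]
  · rw [Prog.exec, r₃ _ (by decide), hs₂, Prog.exec_assign_self]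
    change s₁.regs cur = _
    rw [hr _ (by decide), hcur]
  · rw [Prog.exec, r₃ _ (by decide), r₂ _ (by decide), hr _ (by decide)]
  · rw [Prog.exec, r₃ _ (by decide), r₂ _ (by decide), hr _ (by decide)]

/-- The effect of a complete visit of the subtree rooted at `B`. -/
structure Visited (L : D.Listing) (B : Fin m) (a l lmax U : ℕ) (s s' : RamState Reg) : Prop where
  cur : s'.regs cur = ofOption (L.parent B)
  prev : s'.regs prev = ofFin B
  sp : s'.regs sp = nat (a + (L.nodes B).length * (L.nodes B).length)
  memory : ∀ z < a, s'.memory z = s.memory z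
  used : s'.used ≤ U
  c_le : s'.regs c ≤ s.regs c
  closedWalk : G.IsClosedWalkWeight lmax (s'.regs c)
  covers : G.CoversCycles (D.ownNodes B) (s'.regs c)
  localDist : HasLocalDist L B a l s'.memory

/-- A move that examines the bag `B`. -/
theorem exec_move_examine {s : RamState Reg} {B : Fin m} {a U l lmax : ℕ}
    {o₁ o₂ : Option (Fin m)} (hcur : s.regs cur = ofFin B)
    (ho₁ : (L.children B)[0]? = o₁) (ho₂ : (L.children B)[1]? = o₂)
    (hnext : (if s.regs prev = ofOption (L.parent B) then ofOption o₁ else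
        if s.regs prev = ofOption o₁ then ofOption o₂ else ⊤) = ⊤)
    (hsp : s.regs sp = nat (a + (L.optNodes o₁).length * (L.optNodes o₁).length +
      (L.optNodes o₂).length * (L.optNodes o₂).length))
    (hU : a + (L.optNodes o₁).length * (L.optNodes o₁).length +
      (L.optNodes o₂).length * (L.optNodes o₂).length +
      (L.nodes B).length * (L.nodes B).length ≤ U)
    (hU' : a + (L.nodes B).length * (L.nodes B).length +
      (L.nodes B).length * (L.nodes B).length ≤ U)
    (hused : s.used ≤ U)
    (ho : ∀ j, D.IsChild B j ↔ o₁ = some j ∨ o₂ = some j)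
    (h₁ : ∀ j, o₁ = some j → HasLocalDist L j a l s.memory)
    (h₂ : ∀ j, o₂ = some j → HasLocalDist L j
      (a + (L.optNodes o₁).length * (L.optNodes o₁).length) l s.memory)
    (hc : ∀ j, D.IsChild B j → G.CoversCycles (D.ownNodes j) (s.regs c))
    (hcw : G.IsClosedWalkWeight lmax (s.regs c)) (hl0 : 1 ≤ l)
    (hl : 2 ^ (L.nodes B).length * l ≤ lmax) :
    Visited L B a (2 ^ (L.nodes B).length * l) lmax U s (move.exec L.toInput s) := by
  obtain ⟨s₁, h, hm, hu, hr, hch1, hch2, hn⟩ := exec_move (L := L) hcur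
  rw [ho₁, ho₂, hnext] at hn
  rw [ho₁] at hch1
  rw [ho₂] at hch2
  rw [h, Prog.exec_ifEq_of_eq (by change s₁.regs next = ⊤; exact hn)]
  generalize Expr.cost (.reg next) + Expr.cost (.const ⊤ : Expr Reg) + 1 = τ
  simp only [Prog.block, Prog.exec_seq, Prog.exec_skip]
  have hm' : (s₁.tick τ).memory = s.memory := hm
  have hu' : (s₁.tick τ).used = s.used := hu
  have hr' : ∀ z, z ∉ [ch1, ch2, next] → (s₁.tick τ).regs z = s.regs z := hr
  have hcr := hr' .c (by decide)
  obtain ⟨e1, e2, e3, e4, e5, e6, e7⟩ := exec_examine (L := L) (s := s₁.tick τ)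
    ((hr' _ (by decide)).trans hcur) hch1 hch2 ((hr' _ (by decide)).trans hsp) hU hU'
    (hu'.trans_le hused) ho (hm' ▸ h₁) (hm' ▸ h₂) (hcr ▸ hc) (hcr ▸ hcw) hl0 hl
  rw [hcr] at e4
  rw [hm'] at e2
  set s₂ := examine.exec L.toInput (s₁.tick τ)
  have r₂ : ∀ z, z ∉ examine.writes → s₂.regs z = s₁.regs z :=
    fun z hz => Prog.exec_regs hz (s₁.tick τ)
  clear_value s₂
  have hcur₂ : s₂.regs .cur = ofFin B := by
    rw [r₂ _ (by decide), hr _ (by decide), hcur]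
  set s₃ := Prog.exec L.toInput (.assign .prev Reg.cur) s₂ with hs₃
  have r₃ : ∀ z, z ∉ [Reg.prev] → s₃.regs z = s₂.regs z := fun z hz => Prog.exec_regs hz s₂
  have r₄ : ∀ z, z ∉ [Reg.cur] →
      (Prog.exec L.toInput (.assign .cur (.parent Reg.cur)) s₃).regs z = s₃.regs z :=
    fun z hz => Prog.exec_regs hz s₃
  have hc₄ : (Prog.exec L.toInput (.assign .cur (.parent Reg.cur)) s₃).regs .c = s₂.regs .c := by
    rw [r₄ _ (by decide), r₃ _ (by decide)]
  refine ⟨?_, ?_, ?_, e2, e3, ?_, ?_, ?_, e7⟩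
  · rw [Prog.exec_assign_self]
    change L.toInput.parent (s₃.regs .cur) = _
    rw [r₃ _ (by decide), hcur₂, L.parent_ofFin]
  · rw [r₄ _ (by decide), hs₃, Prog.exec_assign_self]
    exact hcur₂
  · rw [r₄ _ (by decide), r₃ _ (by decide), e1]
  · rw [hc₄]; exact e4
  · rw [hc₄]; exact e5
  · rw [hc₄]; exact e6

end MinCycle

/-! ### Induction over the depth-first traversal -/

namespace MinCycle

open Reg

variable {n : ℕ} {G : WeightedDigraph n} {m : ℕ} {D : TreeDecomposition G m} {L : D.Listing}

theorem Visited.mono_length {B : Fin m} {a l l' lmax U : ℕ} {s s' : RamState Reg}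
    (h : Visited L B a l lmax U s s') (hl : l ≤ l') : Visited L B a l' lmax U s s' := by
  obtain ⟨f, h1, h2, h3⟩ := h.localDist
  exact ⟨h.cur, h.prev, h.sp, h.memory, h.used, h.c_le, h.closedWalk, h.covers,
    f, h1, h2.mono hl, h3⟩

theorem Visited.of_eq {B : Fin m} {a l lmax U : ℕ} {s₀ s s' : RamState Reg}
    (h : Visited L B a l lmax U s s') (hm : ∀ z < a, s.memory z = s₀.memory z)
    (hc : s.regs c ≤ s₀.regs c) : Visited L B a l lmax U s₀ s' :=
  ⟨h.cur, h.prev, h.sp, fun z hz => (h.memory z hz).trans (hm z hz), h.used, h.c_le.trans hc,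
    h.closedWalk, h.covers, h.localDist⟩

theorem iterate_regs {s : RamState Reg} {x : ℕ} {z : Reg} (hz : z ≠ t) :
    ((s.setReg t (nat x)).tick 1).regs z = s.regs z :=
  Prog.setReg_tick_regs_of_ne hz _ _ _

theorem iterate_descend {s : RamState Reg} {B j : Fin m} (x : ℕ) (hcur : s.regs cur = ofFin B)
    (hnext : (if s.regs prev = ofOption (L.parent B) then ofOption (L.children B)[0]? else
        if s.regs prev = ofOption (L.children B)[0]? then ofOption (L.children B)[1]? else ⊤)
      = ofFin j) :
    let s' := Prog.iterate L.toInput t move s x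
    s'.regs cur = ofFin j ∧ s'.regs prev = ofFin B ∧ s'.regs sp = s.regs sp ∧
    s'.regs c = s.regs c ∧ s'.memory = s.memory ∧ s'.used = s.used := by
  obtain ⟨h1, h2, h3, h4, h5, h6⟩ := exec_move_descend (L := L) (j := j)
    (s := (s.setReg t (nat x)).tick 1)
    ((iterate_regs (by decide)).trans hcur) (by rw [iterate_regs (by decide)]; exact hnext)
  rw [iterate_regs (by decide)] at h3 h4
  exact ⟨h1, h2, h3, h4, h5, h6⟩

section Visit

variable {K H U lmax : ℕ}

/-- With `a` at most `level * K²`, two maps of children and one new map fit below `(H + 3) * K²`. -/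
theorem iterate_examine (hK : ∀ i, (L.nodes i).length ≤ K) (hH : ∀ i, D.level i ≤ H)
    (hU : (H + 3) * (K * K) ≤ U) (hlmax : 2 ^ (K * (H + 1)) ≤ lmax)
    {s : RamState Reg} {B : Fin m} {a : ℕ} {o₁ o₂ : Option (Fin m)} (x : ℕ)
    (hcur : s.regs cur = ofFin B)
    (ho₁ : (L.children B)[0]? = o₁) (ho₂ : (L.children B)[1]? = o₂)
    (hnext : (if s.regs prev = ofOption (L.parent B) then ofOption o₁ else
        if s.regs prev = ofOption o₁ then ofOption o₂ else ⊤) = ⊤)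
    (hsp : s.regs sp = nat (a + (L.optNodes o₁).length * (L.optNodes o₁).length +
      (L.optNodes o₂).length * (L.optNodes o₂).length))
    (ha : a ≤ D.level B * (K * K)) (hused : s.used ≤ U)
    (ho : ∀ j, D.IsChild B j ↔ o₁ = some j ∨ o₂ = some j)
    (h₁ : ∀ j, o₁ = some j → HasLocalDist L j a (2 ^ (K * (H - D.level B))) s.memory)
    (h₂ : ∀ j, o₂ = some j → HasLocalDist L j
      (a + (L.optNodes o₁).length * (L.optNodes o₁).length) (2 ^ (K * (H - D.level B))) s.memory)
    (hc : ∀ j, D.IsChild B j → G.CoversCycles (D.ownNodes j) (s.regs c))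
    (hcw : G.IsClosedWalkWeight lmax (s.regs c)) :
    Visited L B a (2 ^ (K * (H + 1 - D.level B))) lmax U s
      (Prog.iterate L.toInput t move s x) := by
  have hKo : ∀ o, (L.optNodes o).length * (L.optNodes o).length ≤ K * K := by
    intro o
    cases o with
    | none => simp [TreeDecomposition.Listing.optNodes]
    | some j => exact Nat.mul_le_mul (hK j) (hK j)
  have hN := Nat.mul_le_mul (hK B) (hK B)
  have h1 := hKo o₁
  have h2 := hKo o₂
  have hlev : D.level B * (K * K) ≤ H * (K * K) := Nat.mul_le_mul_right _ (hH B)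
  -- Going up one level adds at most `K` doublings to the exponent.
  have hpow : 2 ^ (L.nodes B).length * 2 ^ (K * (H - D.level B)) ≤
      2 ^ (K * (H + 1 - D.level B)) := by
    rw [← pow_add, Nat.sub_add_comm (hH B), mul_add, mul_one, add_comm]
    exact Nat.pow_le_pow_right (by omega) (Nat.add_le_add_left (hK B) _)
  have hpow' : 2 ^ (K * (H + 1 - D.level B)) ≤ lmax :=
    (Nat.pow_le_pow_right (by omega) (Nat.mul_le_mul_left K (Nat.sub_le _ _))).trans hlmax
  rw [add_mul] at hU
  have hcs : ((s.setReg t (nat x)).tick 1).regs c = s.regs c := iterate_regs (by decide)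
  refine ((exec_move_examine (L := L) (s := (s.setReg t (nat x)).tick 1)
    ((iterate_regs (by decide)).trans hcur) ho₁ ho₂
    (by rw [iterate_regs (by decide)]; exact hnext) ((iterate_regs (by decide)).trans hsp)
    (by omega) (by omega) hused ho h₁ h₂ (by rw [hcs]; exact hc) (by rw [hcs]; exact hcw)
    (Nat.one_le_two_pow) (hpow.trans hpow')).mono_length hpow).of_eq (fun _ _ => rfl) hcs.le

/-- The moves of the traversal visit the subtree rooted at `B`. -/
theorem visit (hb : D.IsBinary) (hK : ∀ i, (L.nodes i).length ≤ K) (hH : ∀ i, D.level i ≤ H)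
    (hU : (H + 3) * (K * K) ≤ U) (hlmax : 2 ^ (K * (H + 1)) ≤ lmax)
    {B : Fin m} {ts : List ℕ} (hts : ts.length + 1 = 2 * (D.subtree B).ncard)
    {s : RamState Reg} {a : ℕ} (hcur : s.regs cur = ofFin B)
    (hprev : s.regs prev = ofOption (L.parent B)) (hsp : s.regs sp = nat a)
    (ha : a ≤ D.level B * (K * K)) (hused : s.used ≤ U)
    (hcw : G.IsClosedWalkWeight lmax (s.regs c)) :
    Visited L B a (2 ^ (K * (H + 1 - D.level B))) lmax U s
      (ts.foldl (Prog.iterate L.toInput t move) s) := by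
  -- The remaining height drops at every child. The list of loop counters is generalized too, since
  -- a child is visited during a segment of it.
  induction hd : H - D.level B using Nat.strong_induction_on generalizing B ts s a with
  | _ d ih =>
  subst hd
  have hcard := L.ncard_subtree B
  have hlen := L.length_children_le hb B
  have hmem := fun j => L.mem_children B j
  have hfin := @iterate_examine n G m D L K H U lmax hK hH hU hlmax
  -- the visit of a child
  have hchild : ∀ j, D.IsChild B j → ∀ (ts : List ℕ), ts.length + 1 = 2 * (D.subtree j).ncard →
      ∀ (s : RamState Reg) (a : ℕ), s.regs cur = ofFin j → s.regs prev = ofFin B →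
      s.regs sp = nat a → a ≤ (D.level B + 1) * (K * K) → s.used ≤ U →
      G.IsClosedWalkWeight lmax (s.regs c) →
      Visited L j a (2 ^ (K * (H - D.level B))) lmax U s
        (ts.foldl (Prog.iterate L.toInput t move) s) := by
    intro j hj ts hts s a h1 h2 h3 h4 h5 h6
    have hl := hj.level_eq
    have := hH j
    have e : H - D.level B = H + 1 - D.level j := by omega
    rw [e]
    refine ih (H - D.level j) (by omega) hts h1 ?_ h3 (hl ▸ h4) h5 h6 rfl
    rw [h2, (L.parent_eq_some B j).2 hj, ofOption_some]
  have hparent : ∀ j, D.IsChild B j → ofOption (L.parent j) = ofFin B := by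
    intro j hj
    rw [(L.parent_eq_some B j).2 hj, ofOption_some]
  -- Levels separate a child from the parent, so a return from a child is never mistaken for the
  -- first arrival from above.
  have hne : ∀ j, D.IsChild B j → (ofFin j : Word) ≠ ofOption (L.parent B) := by
    intro j hj e
    have h := (L.parent_eq_some j B).1 (ofOption_eq_ofFin.1 e.symm)
    have h1 := h.level_eq
    have h2 := hj.level_eq
    omega
  have haK : a ≤ (D.level B + 1) * (K * K) := ha.trans (Nat.mul_le_mul_right _ (by omega))
  have hpos : ∀ j, 0 < (D.subtree j).ncard := fun j =>
    (Set.ncard_pos (Set.toFinite _)).2 ⟨j, TreeDecomposition.self_mem_subtree j⟩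
  rcases hch : L.children B with _ | ⟨j₁, _ | ⟨j₂, _ | ⟨j₃, l⟩⟩⟩
  · rw [hch, List.map_nil, List.sum_nil] at hcard
    obtain ⟨x, rfl⟩ := List.length_eq_one_iff.1 (by omega : ts.length = 1)
    have hno : ∀ j, ¬ D.IsChild B j := fun j hj => by
      have := (hmem j).2 hj
      simp [hch] at this
    refine hfin (o₁ := none) (o₂ := none) x hcur (by rw [hch]; rfl) (by rw [hch]; rfl)
      (by rw [if_pos hprev]; rfl) hsp ha hused (fun j => ?_) (by simp) (by simp)
      (fun j hj => absurd hj (hno j)) hcw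
    simp [hno]
  · have hj₁ : D.IsChild B j₁ := (hmem j₁).1 (by simp [hch])
    rw [hch, List.map_cons, List.map_nil, List.sum_cons, List.sum_nil] at hcard
    have hp₁ := hpos j₁
    obtain ⟨x, ts, rfl⟩ := List.exists_cons_of_length_pos (by omega : 0 < ts.length)
    rw [List.length_cons] at hts
    obtain ⟨ts₁, y, rfl⟩ : ∃ ts₁ y, ts = ts₁ ++ [y] := by
      refine ⟨_, _, (List.dropLast_append_getLast (l := ts) ?_).symm⟩
      rintro rfl
      rw [List.length_nil] at hts
      omega
    rw [List.length_append, List.length_singleton] at hts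
    simp only [List.foldl_cons, List.foldl_append, List.foldl_nil]
    obtain ⟨d1, d2, d3, d4, d5, d6⟩ := iterate_descend (L := L) (j := j₁) x hcur
      (by rw [if_pos hprev, hch]; rfl)
    set s₁ := Prog.iterate L.toInput t move s x
    have v := hchild j₁ hj₁ ts₁ (by omega) s₁ a d1 d2 (d3.trans hsp) haK (d6.trans_le hused)
      (d4.symm ▸ hcw)
    set s₂ := ts₁.foldl (Prog.iterate L.toInput t move) s₁
    refine (hfin (o₁ := some j₁) (o₂ := none) y (v.cur.trans (hparent _ hj₁)) (by rw [hch]; rfl)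
      (by rw [hch]; rfl) ?_ v.sp ha v.used (fun j => ?_) ?_ (by simp) ?_ v.closedWalk).of_eq
      (fun z hz => (v.memory z hz).trans (by rw [d5])) (v.c_le.trans d4.le)
    -- Coming back from the only child selects the null second child, which triggers the
    -- examination.
    · rw [v.prev, if_neg (hne _ hj₁), ofOption_some, if_pos rfl, ofOption_none]
    · rw [← hmem, hch]
      simp [eq_comm]
    · rintro j ⟨⟩
      exact v.localDist
    · intro j hj
      rw [← hmem, hch, List.mem_singleton] at hj
      exact hj ▸ v.covers
  · have hj₁ : D.IsChild B j₁ := (hmem j₁).1 (by simp [hch])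
    have hj₂ : D.IsChild B j₂ := (hmem j₂).1 (by simp [hch])
    have h12 : j₁ ≠ j₂ := by
      have := L.children_nodup B
      rw [hch] at this
      simpa using this
    rw [hch] at hcard
    simp only [List.map_cons, List.map_nil, List.sum_cons, List.sum_nil] at hcard
    have hp₁ := hpos j₁
    have hp₂ := hpos j₂
    -- The moves are: descend (`x`), visit the first child (`ts₁`), descend (`y`), visit the second
    -- (`ts₂`), examine (`w`). The counts add up to twice the size of the subtree minus one.
    obtain ⟨x, y, w, ts₁, ts₂, rfl, ht₁, ht₂⟩ : ∃ x y w ts₁ ts₂,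
        ts = x :: (ts₁ ++ y :: (ts₂ ++ [w])) ∧ ts₁.length + 1 = 2 * (D.subtree j₁).ncard ∧
        ts₂.length + 1 = 2 * (D.subtree j₂).ncard := by
      obtain ⟨x, ts, rfl⟩ := List.exists_cons_of_length_pos (by omega : 0 < ts.length)
      rw [List.length_cons] at hts
      have hd := List.take_append_drop (2 * (D.subtree j₁).ncard - 1) ts
      have hl₁ : (ts.take (2 * (D.subtree j₁).ncard - 1)).length =
        2 * (D.subtree j₁).ncard - 1 := by rw [List.length_take]; omega
      have hl₂ := List.length_drop (i := 2 * (D.subtree j₁).ncard - 1) (l := ts)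
      obtain ⟨y, us, hus⟩ := List.exists_cons_of_length_pos
        (by omega : 0 < (ts.drop (2 * (D.subtree j₁).ncard - 1)).length)
      rw [hus, List.length_cons] at hl₂
      obtain ⟨ts₂, w, rfl⟩ : ∃ ts₂ w, us = ts₂ ++ [w] := by
        refine ⟨_, _, (List.dropLast_append_getLast (l := us) ?_).symm⟩
        rintro rfl
        rw [List.length_nil] at hl₂
        omega
      rw [List.length_append, List.length_singleton] at hl₂
      refine ⟨x, y, w, ts.take (2 * (D.subtree j₁).ncard - 1), ts₂, ?_, by omega, by omega⟩
      rw [← hus, hd]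
    simp only [List.foldl_cons, List.foldl_append, List.foldl_nil]
    obtain ⟨d1, d2, d3, d4, d5, d6⟩ := iterate_descend (L := L) (j := j₁) x hcur
      (by rw [if_pos hprev, hch]; rfl)
    set s₁ := Prog.iterate L.toInput t move s x
    have v := hchild j₁ hj₁ ts₁ ht₁ s₁ a d1 d2 (d3.trans hsp) haK (d6.trans_le hused)
      (d4.symm ▸ hcw)
    set s₂ := ts₁.foldl (Prog.iterate L.toInput t move) s₁
    obtain ⟨e1, e2, e3, e4, e5, e6⟩ := iterate_descend (L := L) (j := j₂) y
      (v.cur.trans (hparent _ hj₁)) (by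
        rw [v.prev, if_neg (hne _ hj₁), hch, if_pos (by rfl)]; rfl)
    set s₃ := Prog.iterate L.toInput t move s₂ y
    have v' := hchild j₂ hj₂ ts₂ ht₂ s₃ _ e1 e2 (e3.trans v.sp)
      (by rw [add_mul, one_mul]; exact Nat.add_le_add ha (Nat.mul_le_mul (hK _) (hK _)))
      (e6.trans_le v.used) (e4.symm ▸ v.closedWalk)
    set s₄ := ts₂.foldl (Prog.iterate L.toInput t move) s₃
    -- The second visit starts its stack just above the map of `j₁` and leaves everything below
    -- untouched.
    have hmem₄ : ∀ z < a + (L.nodes j₁).length * (L.nodes j₁).length,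
        s₄.memory z = s₂.memory z := fun z hz => (v'.memory z hz).trans (by rw [e5])
    refine (hfin (o₁ := some j₁) (o₂ := some j₂) w (v'.cur.trans (hparent _ hj₂))
      (by rw [hch]; rfl) (by rw [hch]; rfl) ?_ v'.sp ha v'.used (fun j => ?_) ?_ ?_ ?_
      v'.closedWalk).of_eq
      (fun z hz => (hmem₄ z (hz.trans_le (Nat.le_add_right _ _))).trans ((v.memory z hz).trans (by rw [d5])))
      (v'.c_le.trans (e4.le.trans (v.c_le.trans d4.le)))
    · rw [v'.prev, if_neg (hne _ hj₂), ofOption_some, if_neg]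
      rw [ofFin_inj]
      exact h12.symm
    · rw [← hmem, hch]
      simp [eq_comm]
    · rintro j ⟨⟩
      exact v.localDist.congr hmem₄
    · rintro j ⟨⟩
      exact v'.localDist
    · intro j hj
      rw [← hmem, hch, List.mem_pair] at hj
      rcases hj with rfl | rfl
      · exact v.covers.mono (v'.c_le.trans e4.le)
      · exact v'.covers
  · rw [hch] at hlen
    simp at hlen

end Visit

/-! ## The whole program -/

/-- The state in which the traversal begins. -/
theorem run_program (L : D.Listing) : ∃ s : RamState Reg,
    program.run L.toInput = (List.range (2 * m - 1)).foldl (Prog.iterate L.toInput t move) s ∧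
    s.regs c = ⊤ ∧ s.regs sp = nat 0 ∧ s.regs cur = ofFin D.root ∧ s.regs prev = ⊤ ∧
    s.used = 0 ∧ s.time = 14 ∧ ∀ K, SizesBounded K s := by
  have hm : 1 ≤ m := D.root.pos
  rw [Prog.run, program]
  simp only [Prog.block, Prog.exec_seq, Prog.exec_skip]
  rw [Prog.exec_loop_eq]
  have e : Expr.eval L.toInput (Prog.exec L.toInput (.assign prev (.const ⊤))
      (Prog.exec L.toInput (.assign cur .root) (Prog.exec L.toInput (.assign sp (lit 0))
        (Prog.exec L.toInput (.assign c (.const ⊤)) (RamState.init Reg)))))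
      (lit 2 * (.numBags : Expr Reg) - lit 1) = nat (2 * m - 1) := by
    change WithTop.map₂ (fun a b : ℤ => a - b) (WithTop.map₂ (fun a b : ℤ => a * b) (nat 2) (nat m))
      (nat 1) = _
    rw [nat_mul, nat_sub (by omega)]
  rw [e, toNat_nat]
  refine ⟨_, rfl, rfl, rfl, rfl, rfl, rfl, rfl, ?_⟩
  intro K x hx
  refine ⟨0, Nat.zero_le _, ?_⟩
  simp only [List.mem_cons, List.not_mem_nil, or_false] at hx
  rcases hx with rfl | rfl | rfl <;> rfl

/-- The constant 14 pays for the four initial assignments and the bound of the main loop. Each move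
costs a constant whatever the state, so correctness of the traversal is not needed. -/
theorem timeOn_program_le {width : ℕ} (L : D.Listing) (hw : D.WidthAtMost width) :
    program.timeOn L.toInput ≤ 14 + 2 * m * (1 + timeBound (width + 1) move) := by
  obtain ⟨s, h, -, -, -, -, -, ht, hs⟩ := run_program L
  rw [Prog.timeOn, h]
  have key : ∀ N, SizesBounded (width + 1)
        ((List.range N).foldl (Prog.iterate L.toInput t move) s) ∧
      ((List.range N).foldl (Prog.iterate L.toInput t move) s).time ≤
        14 + N * (1 + timeBound (width + 1) move) := by
    intro N
    induction N with
    | zero => exact ⟨hs _, by simp [ht]⟩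
    | succ N ih =>
      rw [List.range_succ, List.foldl_append, List.foldl_cons, List.foldl_nil]
      obtain ⟨h1, h2⟩ := exec_time_le (L.exists_bagSize hw) loopsBySizes_move
        (ih.1.setReg (x := t) (by decide) (nat N) 1)
      refine ⟨h1, h2.trans ?_⟩
      have := ih.2
      rw [add_mul, one_mul, RamState.tick, RamState.setReg]
      dsimp only
      omega
  exact (key _).2.trans (Nat.add_le_add_left (Nat.mul_le_mul_right _ (Nat.sub_le _ _)) _)

theorem program_spec {width H : ℕ} (L : D.Listing) (hb : D.IsBinary) (hw : D.WidthAtMost width)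
    (hH : ∀ i, D.level i ≤ H) :
    (program.run L.toInput).used ≤ (H + 3) * ((width + 1) * (width + 1)) ∧
    G.IsClosedWalkWeight (2 ^ ((width + 1) * (H + 1))) (program.output L.toInput c) ∧
    ∀ u ys w, G.HasWalk u ys u w → (u :: ys).Nodup → program.output L.toInput c ≤ (w : ℤ) := by
  obtain ⟨s, h, hc, hsp, hcur, hprev, hu, -, -⟩ := run_program L
  have hm : 1 ≤ m := D.root.pos
  -- Thus the initial null value of `prev` makes the start at the root look like an arrival from its
  -- parent.
  have hroot : L.parent D.root = none := by
    rw [Option.eq_none_iff_forall_not_mem]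
    intro p hp
    have := ((L.parent_eq_some p D.root).1 hp).level_eq
    simp [TreeDecomposition.level] at this
  have v := visit (L := L) (s := s) (B := D.root) (a := 0) (ts := List.range (2 * m - 1)) hb
    (L.length_nodes_le hw) hH le_rfl le_rfl
    (by rw [TreeDecomposition.ncard_subtree_root, List.length_range]; omega) hcur (by rw [hprev, hroot]; rfl) hsp
    (Nat.zero_le _) (by rw [hu]; exact Nat.zero_le _) (by rw [hc]; exact .inl rfl)
  rw [Prog.output, h]
  exact ⟨v.used, v.closedWalk, fun u ys w hw hn => v.covers u ys w hw hn
    fun y _ => TreeDecomposition.mem_ownNodes_root y⟩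

end MinCycle

/-! ### Choice of the constant -/

/-- Since `a < 2 ^ a`, the factor `a` costs an additive constant in the logarithm, and `n ≥ 2` lets
`log n ≥ 1` absorb constants. -/
theorem log_le_of_le_mul {a m n : ℕ} (hn : 2 ≤ n) (h : m ≤ a * n) :
    Nat.log 2 m + 1 ≤ (a + 2) * Nat.log 2 n := by
  have hl : 1 ≤ Nat.log 2 n := Nat.le_log_of_pow_le (by omega) (by omega)
  have h1 : Nat.log 2 m < a + (Nat.log 2 n + 1) := by
    apply Nat.log_lt_of_lt_pow' (by omega)
    calc m ≤ a * n := h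
      _ < 2 ^ a * 2 ^ (Nat.log 2 n + 1) :=
        Nat.mul_lt_mul_of_lt_of_lt (Nat.lt_two_pow_self) (Nat.lt_pow_succ_log_self (by omega) n)
      _ = 2 ^ (a + (Nat.log 2 n + 1)) := (pow_add _ _ _).symm
  have : a ≤ a * Nat.log 2 n := Nat.le_mul_of_pos_right a hl
  rw [add_mul]
  omega

theorem mainTheorem4 (width bagFactor heightFactor : ℕ) :
    ∃ C : ℕ, ∀ (n m : ℕ) (G : WeightedDigraph n) (D : TreeDecomposition G m) (L : D.Listing),
      D.IsBinary → D.WidthAtMost width → m ≤ bagFactor * n → D.BalancedWith heightFactor →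
      MinCycle.program.timeOn L.toInput ≤ C * n ∧
      (2 ≤ n → MinCycle.program.spaceOn L.toInput ≤ C * Nat.log 2 n) ∧
      (¬ G.HasNegativeCycle →
        MinCycle.program.output L.toInput MinCycle.Reg.c = G.minCycleWeight) ∧
      (G.HasNegativeCycle →
        MinCycle.program.output L.toInput MinCycle.Reg.c ≤ G.minCycleWeight ∧
        ∃ c cstar : ℤ,
          MinCycle.program.output L.toInput MinCycle.Reg.c = (c : WithTop ℤ) ∧
          G.minCycleWeight = (cstar : WithTop ℤ) ∧
          |cstar| ≤ |c| ∧ (2 ≤ n → |c| ≤ |cstar| * (n : ℤ) ^ C)) := by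
  set T := 1 + MinCycle.timeBound (width + 1) MinCycle.move
  set h := heightFactor * (bagFactor + 2)
  set A := Fintype.card MinCycle.Reg + 2 * MinCycle.program.loopDepth
  set C₁ := 14 + 2 * bagFactor * T
  set C₂ := A + (h + 3) * ((width + 1) * (width + 1))
  set C₃ := (width + 1) * (h + 1)
  refine ⟨C₁ + C₂ + C₃, ?_⟩
  intro n m G D L hb hw hm hbal
  have hm0 : 1 ≤ m := D.root.pos
  -- The root bag makes `m` positive, which excludes `n = 0`; the additive 14 can then be charged to
  -- `14 * n`.
  have hn0 : 1 ≤ n := by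
    rcases Nat.eq_zero_or_pos n with rfl | h
    · omega
    · exact h
  obtain ⟨hused, hcl, hcov⟩ := MinCycle.program_spec L hb hw hbal
  have hlog : 2 ≤ n → heightFactor * (Nat.log 2 m + 1) ≤ h * Nat.log 2 n := by
    intro hn
    rw [mul_assoc]
    exact Nat.mul_le_mul_left _ (log_le_of_le_mul hn hm)
  refine ⟨?_, ?_, fun hG => WeightedDigraph.eq_minCycleWeight hG hcl hcov, ?_⟩
  · refine (MinCycle.timeOn_program_le L hw).trans ?_
    calc 14 + 2 * m * T ≤ 14 * n + 2 * (bagFactor * n) * T :=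
          Nat.add_le_add (by omega) (Nat.mul_le_mul_right _ (Nat.mul_le_mul_left _ hm))
      _ = C₁ * n := by ring
      _ ≤ (C₁ + C₂ + C₃) * n := Nat.mul_le_mul_right _ (by omega)
  · intro hn
    have hl : 1 ≤ Nat.log 2 n := Nat.le_log_of_pow_le (by omega) (by omega)
    calc MinCycle.program.spaceOn L.toInput
        ≤ A + (heightFactor * (Nat.log 2 m + 1) + 3) * ((width + 1) * (width + 1)) :=
          Nat.add_le_add_left hused _
      _ ≤ A * Nat.log 2 n + (h * Nat.log 2 n + 3 * Nat.log 2 n) * ((width + 1) * (width + 1)) :=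
          Nat.add_le_add (Nat.le_mul_of_pos_right _ hl)
            (Nat.mul_le_mul_right _ (Nat.add_le_add (hlog hn) (by omega)))
      _ = C₂ * Nat.log 2 n := by ring
      _ ≤ (C₁ + C₂ + C₃) * Nat.log 2 n := Nat.mul_le_mul_right _ (by omega)
  · intro hG
    obtain ⟨h1, c, cstar, h2, h3, h4, h5⟩ := WeightedDigraph.approx_minCycleWeight hG hcl hcov
    refine ⟨h1, c, cstar, h2, h3, h4, fun hn => h5.trans ?_⟩
    have hl : 1 ≤ Nat.log 2 n := Nat.le_log_of_pow_le (by omega) (by omega)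
    -- The edge bound is exponential in the height, hence polynomial in `n`: its exponent is at most
    -- `C₃ * Nat.log 2 n`, and `2 ^ Nat.log 2 n ≤ n`.
    have : 2 ^ ((width + 1) * (heightFactor * (Nat.log 2 m + 1) + 1)) ≤ n ^ (C₁ + C₂ + C₃) :=
      calc 2 ^ ((width + 1) * (heightFactor * (Nat.log 2 m + 1) + 1))
          ≤ 2 ^ ((width + 1) * (h * Nat.log 2 n + Nat.log 2 n)) :=
            Nat.pow_le_pow_right (by omega)
              (Nat.mul_le_mul_left _ (Nat.add_le_add (hlog hn) hl))
        _ = (2 ^ Nat.log 2 n) ^ C₃ := by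
            rw [← pow_mul]
            congr 1
            ring
        _ ≤ n ^ C₃ := Nat.pow_le_pow_left (Nat.pow_log_le_self 2 (by omega)) _
        _ ≤ n ^ (C₁ + C₂ + C₃) := Nat.pow_le_pow_right hn0 (by omega)
    exact mul_le_mul_of_nonneg_left (by exact_mod_cast this) (abs_nonneg _)
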